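/- **Quantum Threshold Search (online).** For a quantum state $\rho \in \mathbb{C}^{d\times d}$ ($\rho \ge 0$, $\operatorname{tr}\rho = 1$) and an observable $A$ write $\mathbb{E}_\rho[A] = \operatorname{tr}(\rho A)$. There are a universal constant $C > 0$ and a function $n_{\mathrm{TS}}(m,\varepsilon,\delta)$ such that, for all integers $m \ge 1$ and all $0 < \varepsilon, \delta < \tfrac12$, with $L = \log(1/\delta)$, $$ n := n_{\mathrm{TS}}(m,\varepsilon,\delta) \;\le\; \frac{\log^2 m + L}{\varepsilon^2}\cdot C L, $$ and the following holds for every dimension $d$. There is an online quantum algorithm (a sequence of quantum measurements on a finite-dimensional memory) that is initially given $\rho^{\otimes n}$ for an unknown $d$-dimensional state $\rho$. Then pairs $(A_1,\theta_1), \dots, (A_m,\theta_m)$, where $A_t \in \mathbb{C}^{d\times d}$ is an observable with $0 \le A_t \le \mathbb{1}$ and $0 \le \theta_t \le 1$ is a threshold, are presented to it in sequence. When $(A_t,\theta_t)$ is presented, the algorithm, which has seen only the first $t$ pairs, must either "pass", or else halt and output "$\mathbb{E}_\rho[A_t] > \theta_t - \varepsilon$". If it passes on all $m$ pairs, it ends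 by outputting "$\mathbb{E}_\rho[A_i] \le \theta_i$ for all $i$". For every state $\rho$ and every sequence of pairs, the probability that the output statement is false is at most $\delta$. In particular, the corresponding offline problem, in which the list of all $m$ pairs is given in advance, can be solved with $n$ copies of $\rho$ and failure probability at most $\delta$. -/

import Mathlib

open scoped Matrix ComplexOrder

namespace ThresholdSearch

/-- A `d`-dimensional quantum state (density matrix): `ρ ≥ 0` and `tr ρ = 1`. -/
def IsState {d : ℕ} (ρ : Matrix (Fin d) (Fin d) ℂ) : Prop :=
  ρ.PosSemidef ∧ ρ.trace = 1

/-- A `d`-dimensional quantum event: an observable `A` with `0 ≤ A ≤ 1`. -/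
def IsEvent {d : ℕ} (A : Matrix (Fin d) (Fin d) ℂ) : Prop :=
  A.PosSemidef ∧ (1 - A).PosSemidef

/-- The expectation `E_ρ[A] = tr(ρ A)`. For self-adjoint `ρ` and `A` this trace is a real number;
the real part only serves to view it in `ℝ`. -/
noncomputable def expect {d : ℕ} (ρ A : Matrix (Fin d) (Fin d) ℂ) : ℝ :=
  (ρ * A).trace.re

/-- The state `ρ^{⊗ n}` of `n` unentangled copies of `ρ`. The computational basis of
`(ℂ^d)^{⊗ n}` is indexed by the functions `Fin n → Fin d`. -/
noncomputable def copies {d : ℕ} (ρ : Matrix (Fin d) (Fin d) ℂ) (n : ℕ) :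
    Matrix (Fin n → Fin d) (Fin n → Fin d) ℂ :=
  Matrix.of fun a b => ∏ i, ρ (a i) (b i)

/-- A quantum instrument with input space `ℂ^V`, output space `ℂ^W` and classical outcomes in `Out`,
given by Kraus operators: the most general finite-dimensional measurement, with state change.
Several Kraus operators may belong to one outcome, and the input and output dimensions may differ,
so ancillas, classical randomness and partial traces are included. -/
structure Instrument (Out V W : Type) [Fintype Out] [Fintype V] [DecidableEq V] [Fintype W] where
  /-- the number of Kraus operators of each outcome (pad with zeros) -/
  rank : ℕ
  /-- the Kraus operators -/
  kraus : Out → Fin rank → Matrix W V ℂ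
  /-- the probabilities of the outcomes sum to one -/
  complete : ∑ o, ∑ k, (kraus o k)ᴴ * kraus o k = 1

/-- The quantum operation of outcome `o`. It maps `σ` to an unnormalized matrix, whose trace is
the probability of `o` and which is that probability times the state after outcome `o`. -/
noncomputable def Instrument.apply {Out V W : Type} [Fintype Out] [Fintype V] [DecidableEq V]
    [Fintype W] (I : Instrument Out V W) (o : Out) (σ : Matrix V V ℂ) : Matrix W W ℂ :=
  ∑ k, I.kraus o k * σ * (I.kraus o k)ᴴ

/-- An input pair `(A, θ)`: an observable `0 ≤ A ≤ 1` and a threshold `0 ≤ θ ≤ 1`. -/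
structure Query (d : ℕ) where
  /-- the observable -/
  obs : Matrix (Fin d) (Fin d) ℂ
  /-- the threshold -/
  threshold : ℝ
  isEvent : IsEvent obs
  threshold_nonneg : 0 ≤ threshold
  threshold_le_one : threshold ≤ 1

/-- The two possible responses to an input pair: pass on to the next pair, or halt (and output
that the expectation of the present observable exceeds its threshold minus `ε`). -/
inductive Response
  | pass
  | halt
  deriving DecidableEq

instance : Fintype Response where
  elems := {Response.pass, Response.halt}
  complete := fun r => by cases r <;> simp

/-- An online quantum algorithm that holds `n` copies of a `d`-dimensional state and receives
`m` input pairs one after the other. It first transforms the copies into a state of its memory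
(a channel, that is, an instrument with one outcome). When pair number `t` is presented it measures
its memory by an instrument that depends only on the pairs presented so far, the present one
included; the outcome tells whether it passes or halts. -/
structure OnlineAlgorithm (d n m : ℕ) where
  /-- the dimension of the memory -/
  memDim : ℕ
  /-- the preparation of the memory from the copies -/
  prepare : Instrument Unit (Fin n → Fin d) (Fin memDim)
  /-- the measurement made when pair number `t` is presented -/
  step : (t : Fin m) → (Fin (t.val + 1) → Query d) →
    Instrument Response (Fin memDim) (Fin memDim)

namespace OnlineAlgorithm

variable {d n m : ℕ}

/-- The instrument that is used at time `t` on the sequence of pairs `q`. -/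
def stepOn (alg : OnlineAlgorithm d n m) (q : Fin m → Query d) (t : Fin m) :
    Instrument Response (Fin alg.memDim) (Fin alg.memDim) :=
  alg.step t fun i => q (Fin.castLE t.isLt i)

/-- The unnormalized memory state after the algorithm has passed on the first `t` pairs: its trace
is the probability that the algorithm passes on all of these. -/
noncomputable def passState (alg : OnlineAlgorithm d n m) (ρ : Matrix (Fin d) (Fin d) ℂ)
    (q : Fin m → Query d) (t : Fin (m + 1)) : Matrix (Fin alg.memDim) (Fin alg.memDim) ℂ :=
  Fin.induction (motive := fun _ => Matrix (Fin alg.memDim) (Fin alg.memDim) ℂ)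
    (alg.prepare.apply () (copies ρ n))
    (fun s σ => (alg.stepOn q s).apply Response.pass σ) t

/-- The probability of each output. The output `some j` is "`E_ρ[A_j] > θ_j - ε`": the algorithm
passes on all earlier pairs and halts at `j`. The output `none` is "`E_ρ[A_i] ≤ θ_i` for all `i`":
the algorithm passes on all `m` pairs. (The trace is a nonnegative real number.) -/
noncomputable def outputProb (alg : OnlineAlgorithm d n m) (ρ : Matrix (Fin d) (Fin d) ℂ)
    (q : Fin m → Query d) : Option (Fin m) → ℝ
  | some j => ((alg.stepOn q j).apply Response.halt (alg.passState ρ q j.castSucc)).trace.re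
  | none => (alg.passState ρ q (Fin.last m)).trace.re

end OnlineAlgorithm

/-- The truth of the output statement for the state `ρ`, the pairs `q` and the accuracy `ε`. -/
def OutputTrue {d m : ℕ} (ρ : Matrix (Fin d) (Fin d) ℂ) (q : Fin m → Query d) (ε : ℝ) :
    Option (Fin m) → Prop
  | some j => expect ρ (q j).obs > (q j).threshold - ε
  | none => ∀ i, expect ρ (q i).obs ≤ (q i).threshold

open Classical in
/-- The probability of a false output statement. -/
noncomputable def OnlineAlgorithm.failureProb {d n m : ℕ} (alg : OnlineAlgorithm d n m)
    (ρ : Matrix (Fin d) (Fin d) ℂ) (q : Fin m → Query d) (ε : ℝ) : ℝ :=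
  ∑ o : Option (Fin m), if OutputTrue ρ q ε o then 0 else alg.outputProb ρ q o

end ThresholdSearch

/-!
The algorithm divides the copies into `O(L)` groups, each of which consists of a search register of
`O((log² m + L) / ε²)` copies and a test register of `O(L / ε²)` copies. When a query `(A, θ)` is
presented, each group measures its search register softly: the sum `∑ᵢ A⁽ⁱ⁾` over the `n` copies
is not read out, but the group halts with probability `softThreshold β T s` if the value of the sum
is `s`, where `T` is slightly below `n θ`. A halt is checked on the fresh test register, and
is reported only if the test accepts; otherwise the group is dead.

Why the soft measurement is gentle. Changing one of `n` independent variables in `[0, 1]` changes the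
soft threshold of their sum by a factor of at most `exp β`. Hence its second moment is at most
`(1 + β²) ^ n` times the square of its mean `p` (`sumMean_softThreshold_sq_le`), so its
standard deviation is `O(√n β p)`. Write `ρ^{⊗ n} = W Wᴴ`. In the Frobenius norm, the Kraus
operator `K` of passing then satisfies `‖K W - √(1 - p) W‖ ≤ κ p` with `κ = √n β`
(`norm_passOp_mul_sub_le`): the damage is proportional to the probability of halting.

Why a sequence of such measurements works. Up to time `t` the vector `W` is ideally multiplied by
`c t = ∏ √(1 - p s)`. The errors `κ (p t) (c t)` that are committed on the way telescope, since
`p t * c t ≤ 2 (c t - c (t + 1))`, so the deviation is at most `2 κ` for all time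
(`norm_deviation_le`). Moreover the deviation contributes at most `O(κ²)` to the total
probability of halting (`sum_norm_halt_deviation_sq_le`). If `√n` is of order `(log m + 1) / ε`, then
`β` can be chosen such that `κ` is a small constant, that the false halts have small total probability,
and that a query with `tr (ρ A) > θ` makes the search halt with constant probability. So a
group reports a true halt with constant probability if there is such a query (`silentProb_le`).

The groups stay in a product state as long as none of them reports a halt, so the probability that the
algorithm passes is a power of the corresponding probability `silentProb` for one group. It is
exponentially small in the number of groups if there is a query with `tr (ρ A) > θ`. False
halts are rare, because each group uses its test only once (`failureProb_le`).
-/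

namespace ThresholdSearch

open scoped Kronecker

/-! ### Tensor products of matrices -/

section Tensor

variable {R : ℕ} {U V W κ : Type} [Fintype U] [Fintype V] [Fintype W] [Fintype κ]

/-- The tensor product `M 0 ⊗ ⋯ ⊗ M (R - 1)`. As in `copies`, the basis of a tensor product
of `R` spaces is indexed by functions on `Fin R`. -/
noncomputable def tensor (M : Fin R → Matrix W V ℂ) : Matrix (Fin R → W) (Fin R → V) ℂ :=
  Matrix.of fun a b => ∏ r, M r (a r) (b r)

omit [Fintype U] [Fintype W] in
theorem tensor_mul (M : Fin R → Matrix W V ℂ) (N : Fin R → Matrix V U ℂ) :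
    tensor M * tensor N = tensor fun r => M r * N r := by
  ext a b
  simp only [tensor, Matrix.mul_apply, Matrix.of_apply, ← Finset.prod_mul_distrib]
  rw [Finset.prod_univ_sum, Fintype.piFinset_univ]

omit [Fintype V] [Fintype W] in
theorem conjTranspose_tensor (M : Fin R → Matrix W V ℂ) :
    (tensor M)ᴴ = tensor fun r => (M r)ᴴ := by
  ext a b
  simp [tensor, Matrix.conjTranspose_apply]

theorem trace_tensor (M : Fin R → Matrix V V ℂ) : (tensor M).trace = ∏ r, (M r).trace := by
  simp only [tensor, Matrix.trace, Matrix.diag_apply, Matrix.of_apply]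
  rw [Finset.prod_univ_sum, Fintype.piFinset_univ]

omit [Fintype V] [Fintype W] in
theorem sum_tensor (M : κ → Matrix W V ℂ) :
    ∑ k : Fin R → κ, tensor (fun r => M (k r)) = tensor fun _ => ∑ k, M k := by
  ext a b
  simp only [tensor, Matrix.sum_apply, Matrix.of_apply]
  rw [Finset.prod_univ_sum, Fintype.piFinset_univ]

omit [Fintype V] in
theorem tensor_one [DecidableEq V] : tensor (fun _ : Fin R => (1 : Matrix V V ℂ)) = 1 := by
  ext a b
  simp only [tensor, Matrix.of_apply, Matrix.one_apply, Finset.prod_ite_zero, funext_iff]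
  simp

end Tensor

/-! ### Instruments from families of Kraus operators -/

section Kraus

variable {Out V W κ : Type} [Fintype Out] [DecidableEq Out] [Fintype V] [DecidableEq V]
  [Fintype W] [Fintype κ]

/-- The instrument whose Kraus operators are `M k`, where `M k` belongs to the outcome `out k`. -/
noncomputable def Instrument.ofKraus (M : κ → Matrix W V ℂ) (out : κ → Out)
    (hM : ∑ k, (M k)ᴴ * M k = 1) : Instrument Out V W where
  rank := Fintype.card κ
  kraus o i := if out ((Fintype.equivFin κ).symm i) = o then M ((Fintype.equivFin κ).symm i) else 0
  complete := by
    rw [Finset.sum_comm, ← hM]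
    refine Fintype.sum_equiv (Fintype.equivFin κ).symm _ _ fun i => ?_
    rw [Finset.sum_eq_single (out ((Fintype.equivFin κ).symm i))]
    · simp
    · intro o _ ho
      simp [Ne.symm ho]
    · simp

theorem Instrument.ofKraus_apply (M : κ → Matrix W V ℂ) (out : κ → Out)
    (hM : ∑ k, (M k)ᴴ * M k = 1) (o : Out) (σ : Matrix V V ℂ) :
    (Instrument.ofKraus M out hM).apply o σ =
      ∑ k, if out k = o then M k * σ * (M k)ᴴ else 0 := by
  unfold Instrument.apply Instrument.ofKraus
  refine Fintype.sum_equiv (Fintype.equivFin κ).symm _ _ fun i => ?_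
  dsimp only
  split_ifs <;> simp

omit [DecidableEq Out] in
/-- The probabilities of the outcomes of an instrument add up to the trace of the input. -/
theorem Instrument.sum_trace_apply (I : Instrument Out V W) (σ : Matrix V V ℂ) :
    ∑ o, (I.apply o σ).trace = σ.trace := by
  have h : ∀ o k, (I.kraus o k * σ * (I.kraus o k)ᴴ).trace =
      ((I.kraus o k)ᴴ * I.kraus o k * σ).trace := fun o k => by
    rw [Matrix.trace_mul_comm, ← Matrix.mul_assoc]
  simp only [Instrument.apply, Matrix.trace_sum, h]
  simp only [← Matrix.trace_sum, ← Finset.sum_mul, I.complete, one_mul]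

end Kraus

/-! ### Exponentially soft thresholds of sums of independent variables -/

/-- The soft threshold: the probability of halting when the measured value is `s`. It grows
exponentially, at rate `β`, until it reaches the cap `1 / 2` just below `T`. -/
noncomputable def softThreshold (β T s : ℝ) : ℝ := min (1 / 2) (Real.exp (β * (s - T)))

theorem softThreshold_pos (β T s : ℝ) : 0 < softThreshold β T s :=
  lt_min (by norm_num) (Real.exp_pos _)

theorem softThreshold_le_half (β T s : ℝ) : softThreshold β T s ≤ 1 / 2 := min_le_left _ _

theorem softThreshold_le_exp (β T s : ℝ) : softThreshold β T s ≤ Real.exp (β * (s - T)) :=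
  min_le_right _ _

theorem le_softThreshold (β T s : ℝ) :
    1 / 2 * (1 - Real.exp (-β * (s - T))) ≤ softThreshold β T s := by
  refine le_min (by linarith [Real.exp_pos (-β * (s - T))]) ?_
  set y := β * (s - T)
  have h : Real.exp y * Real.exp (-β * (s - T)) = 1 := by
    rw [← Real.exp_add, neg_mul, add_neg_cancel, Real.exp_zero]
  have h1 := Real.exp_pos y
  set z := Real.exp (-β * (s - T))
  have h2 : 0 < z := Real.exp_pos _
  nlinarith [sq_nonneg (z - 1), sq_nonneg (Real.exp y - z), sq_nonneg (Real.exp y + z - 2)]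

/-- A positive function on `ℝ` that, over distances at most one, increases by a factor of at
most `exp β` and does not decrease. -/
def ExpLipschitz (β : ℝ) (φ : ℝ → ℝ) : Prop :=
  ∀ s, 0 < φ s ∧ ∀ u, 0 ≤ u → u ≤ 1 → φ s ≤ φ (s + u) ∧ φ (s + u) ≤ Real.exp β * φ s

theorem expLipschitz_softThreshold {β : ℝ} (hβ : 0 ≤ β) (T : ℝ) :
    ExpLipschitz β (softThreshold β T) := by
  refine fun s => ⟨softThreshold_pos _ _ _, fun u hu hu1 => ⟨?_, ?_⟩⟩
  · refine min_le_min le_rfl (Real.exp_le_exp.2 ?_)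
    nlinarith
  · have h1 : 1 ≤ Real.exp β := Real.one_le_exp hβ
    rw [softThreshold, softThreshold, mul_min_of_nonneg _ _ (Real.exp_pos β).le, ← Real.exp_add]
    refine min_le_min (by linarith) (Real.exp_le_exp.2 ?_)
    nlinarith

section Mean

variable {ι : Type} [Fintype ι] (q a : ι → ℝ)

/-- The function `s ↦ 𝔼[φ (s + X)]` of the random variable `X` that takes the value `a j` with
probability `q j`. -/
def shiftMean (φ : ℝ → ℝ) (s : ℝ) : ℝ := ∑ j, q j * φ (s + a j)

/-- `𝔼[φ (X₁ + ⋯ + Xₙ)]` for independent copies `Xᵢ` of the random variable that takes the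
value `a j` with probability `q j`. -/
def sumMean (n : ℕ) (φ : ℝ → ℝ) : ℝ := ∑ x : Fin n → ι, (∏ i, q (x i)) * φ (∑ i, a (x i))

theorem iterate_shiftMean (n : ℕ) (φ : ℝ → ℝ) (s : ℝ) :
    (shiftMean q a)^[n] φ s = ∑ x : Fin n → ι, (∏ i, q (x i)) * φ (s + ∑ i, a (x i)) := by
  induction n generalizing s with
  | zero => simp
  | succ n ih =>
    rw [Function.iterate_succ_apply', shiftMean]
    simp only [ih]
    rw [← (Fin.consEquiv fun _ : Fin (n + 1) => ι).sum_comp, Fintype.sum_prod_type]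
    refine Finset.sum_congr rfl fun j _ => ?_
    rw [Finset.mul_sum]
    refine Finset.sum_congr rfl fun x _ => ?_
    simp [Fin.consEquiv, Fin.prod_univ_succ, Fin.sum_univ_succ, mul_assoc, add_assoc]

theorem sumMean_eq_iterate (n : ℕ) (φ : ℝ → ℝ) :
    sumMean q a n φ = (shiftMean q a)^[n] φ 0 := by
  simp [iterate_shiftMean, sumMean]

variable {q a} (hq : ∀ j, 0 ≤ q j) (hq1 : ∑ j, q j = 1) (ha : ∀ j, 0 ≤ a j) (ha1 : ∀ j, a j ≤ 1)

include hq in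
theorem shiftMean_mono {φ ψ : ℝ → ℝ} (h : φ ≤ ψ) : shiftMean q a φ ≤ shiftMean q a ψ :=
  fun _ => Finset.sum_le_sum fun j _ => mul_le_mul_of_nonneg_left (h _) (hq j)

include hq in
theorem sumMean_mono (n : ℕ) {φ ψ : ℝ → ℝ} (h : φ ≤ ψ) : sumMean q a n φ ≤ sumMean q a n ψ :=
  Finset.sum_le_sum fun x _ =>
    mul_le_mul_of_nonneg_left (h _) (Finset.prod_nonneg fun i _ => hq (x i))

include hq1 in
theorem sumMean_const (n : ℕ) (c : ℝ) : sumMean q a n (fun _ => c) = c := by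
  rw [sumMean, ← Finset.sum_mul, ← Fintype.piFinset_univ, ← Finset.prod_univ_sum]
  simp [hq1]

theorem sumMean_add (n : ℕ) (φ ψ : ℝ → ℝ) :
    sumMean q a n (fun s => φ s + ψ s) = sumMean q a n φ + sumMean q a n ψ := by
  simp [sumMean, mul_add, Finset.sum_add_distrib]

theorem sumMean_const_mul (n : ℕ) (c : ℝ) (φ : ℝ → ℝ) :
    sumMean q a n (fun s => c * φ s) = c * sumMean q a n φ := by
  simp only [sumMean, Finset.mul_sum]
  exact Finset.sum_congr rfl fun x _ => by ring

include hq hq1 ha ha1 in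
theorem ExpLipschitz.shiftMean {β : ℝ} {φ : ℝ → ℝ} (h : ExpLipschitz β φ) :
    ExpLipschitz β (shiftMean q a φ) := by
  refine fun s => ⟨?_, fun u hu hu1 => ⟨?_, ?_⟩⟩
  · calc 0 < φ s := (h s).1
      _ = ∑ j, q j * φ s := by rw [← Finset.sum_mul, hq1, one_mul]
      _ ≤ _ := Finset.sum_le_sum fun j _ =>
        mul_le_mul_of_nonneg_left ((h s).2 _ (ha j) (ha1 j)).1 (hq j)
  · refine Finset.sum_le_sum fun j _ => mul_le_mul_of_nonneg_left ?_ (hq j)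
    rw [add_right_comm]
    exact ((h _).2 u hu hu1).1
  · rw [ThresholdSearch.shiftMean, ThresholdSearch.shiftMean, Finset.mul_sum]
    refine Finset.sum_le_sum fun j _ => ?_
    rw [add_right_comm, mul_left_comm]
    exact mul_le_mul_of_nonneg_left ((h _).2 u hu hu1).2 (hq j)

include hq hq1 ha ha1 in
/-- A random variable with values in an interval `[b, exp β * b]` has a second moment of at most
`(1 + exp β)² / (4 exp β) ≤ 1 + β²` times the square of its mean. -/
theorem shiftMean_sq_le {β : ℝ} (hβ : 0 ≤ β) (hβ1 : β ≤ 1) {φ : ℝ → ℝ} (h : ExpLipschitz β φ)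
    (s : ℝ) : shiftMean q a (fun s => φ s ^ 2) s ≤ (1 + β ^ 2) * shiftMean q a φ s ^ 2 := by
  set M := Real.exp β with hM
  have hM1 : 1 ≤ M := Real.one_le_exp hβ
  have hM2 : M - 1 ≤ 2 * β := by
    have := Real.abs_exp_sub_one_le (x := β) (by rwa [abs_of_nonneg hβ])
    rw [abs_of_nonneg hβ] at this
    exact (le_abs_self _).trans this
  have hb := (h s).1
  set b := φ s
  set μ := shiftMean q a φ s with hμ
  have key : shiftMean q a (fun s => φ s ^ 2) s ≤ (1 + M) * b * μ - M * b ^ 2 := by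
    calc shiftMean q a (fun s => φ s ^ 2) s
        ≤ ∑ j, ((1 + M) * b * (q j * φ (s + a j)) - q j * (M * b ^ 2)) := by
          refine Finset.sum_le_sum fun j _ => ?_
          obtain ⟨h1, h2⟩ := (h s).2 (a j) (ha j) (ha1 j)
          have := mul_nonneg (hq j) (mul_nonneg (sub_nonneg.2 h1) (sub_nonneg.2 h2))
          nlinarith
      _ = _ := by
          rw [Finset.sum_sub_distrib, ← Finset.mul_sum, ← Finset.sum_mul, hq1, one_mul]; rfl
  have h4 : 4 * M * ((1 + M) * b * μ - M * b ^ 2) ≤ (1 + M) ^ 2 * μ ^ 2 := by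
    nlinarith [sq_nonneg ((1 + M) * μ - 2 * M * b)]
  have h5 : (1 + M) ^ 2 ≤ 4 * M * (1 + β ^ 2) := by
    nlinarith [mul_nonneg (sub_nonneg.2 hM1) (sq_nonneg β)]
  have h6 := mul_le_mul_of_nonneg_right h5 (sq_nonneg μ)
  have h7 : 4 * M * ((1 + M) * b * μ - M * b ^ 2) ≤ 4 * M * ((1 + β ^ 2) * μ ^ 2) := by linarith
  exact key.trans (le_of_mul_le_mul_left h7 (by linarith))

include hq hq1 ha ha1 in
theorem iterate_shiftMean_sq_le {β : ℝ} (hβ : 0 ≤ β) (hβ1 : β ≤ 1) (n : ℕ) {φ : ℝ → ℝ}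
    (h : ExpLipschitz β φ) (s : ℝ) : (shiftMean q a)^[n] (fun s => φ s ^ 2) s ≤
      (1 + β ^ 2) ^ n * ((shiftMean q a)^[n] φ s) ^ 2 := by
  have hL : ∀ n, ExpLipschitz β ((shiftMean q a)^[n] φ) := fun n => by
    induction n with
    | zero => exact h
    | succ n ih =>
      rw [Function.iterate_succ_apply']
      exact ih.shiftMean hq hq1 ha ha1
  induction n generalizing s with
  | zero => simp
  | succ n ih =>
    rw [Function.iterate_succ_apply', Function.iterate_succ_apply']
    calc shiftMean q a ((shiftMean q a)^[n] fun s => φ s ^ 2) s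
        ≤ shiftMean q a (fun s => (1 + β ^ 2) ^ n * ((shiftMean q a)^[n] φ s) ^ 2) s :=
          shiftMean_mono hq ih s
      _ = (1 + β ^ 2) ^ n * shiftMean q a (fun s => ((shiftMean q a)^[n] φ s) ^ 2) s := by
          simp only [shiftMean, Finset.mul_sum]
          exact Finset.sum_congr rfl fun x _ => by ring
      _ ≤ (1 + β ^ 2) ^ n * ((1 + β ^ 2) * shiftMean q a ((shiftMean q a)^[n] φ) s ^ 2) :=
          mul_le_mul_of_nonneg_left (shiftMean_sq_le hq hq1 ha ha1 hβ hβ1 (hL n) s) (by positivity)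
      _ = _ := by ring

include hq hq1 ha ha1 in
/-- The soft threshold of a sum of `n` independent variables has a small relative variance, because
each of the variables changes it by a factor of at most `exp β` only. -/
theorem sumMean_softThreshold_sq_le {β : ℝ} (hβ : 0 ≤ β) (hβ1 : β ≤ 1) (n : ℕ)
    (hn : n * β ^ 2 ≤ 1) (T : ℝ) : sumMean q a n (fun s => softThreshold β T s ^ 2) ≤
      (1 + 2 * (n * β ^ 2)) * sumMean q a n (softThreshold β T) ^ 2 := by
  rw [sumMean_eq_iterate, sumMean_eq_iterate]
  refine (iterate_shiftMean_sq_le hq hq1 ha ha1 hβ hβ1 n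
    (expLipschitz_softThreshold hβ T) 0).trans (mul_le_mul_of_nonneg_right ?_ (sq_nonneg _))
  have h0 : 0 ≤ n * β ^ 2 := by positivity
  calc (1 + β ^ 2) ^ n ≤ Real.exp (β ^ 2) ^ n :=
        pow_le_pow_left₀ (by positivity) (by linarith [Real.add_one_le_exp (β ^ 2)]) n
    _ = Real.exp (n * β ^ 2) := (Real.exp_nat_mul _ _).symm
    _ ≤ 1 + 2 * (n * β ^ 2) := by
        have := Real.abs_exp_sub_one_le (x := n * β ^ 2) (by rwa [abs_of_nonneg h0])
        rw [abs_of_nonneg h0] at this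
        linarith [le_abs_self (Real.exp (n * β ^ 2) - 1)]

include hq hq1 ha ha1 in
/-- A bound on the moment generating function, at both positive and negative arguments. -/
theorem sumMean_exp_le {γ : ℝ} (hγ : |γ| ≤ 1) (n : ℕ) :
    sumMean q a n (fun s => Real.exp (γ * s)) ≤
      Real.exp (γ * (n * ∑ j, q j * a j) + n * γ ^ 2) := by
  have h1 : ∑ j, q j * Real.exp (γ * a j) ≤ Real.exp (γ * (∑ j, q j * a j) + γ ^ 2) := by
    calc ∑ j, q j * Real.exp (γ * a j) ≤ ∑ j, (q j + γ * (q j * a j) + q j * γ ^ 2) := by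
          refine Finset.sum_le_sum fun j _ => ?_
          have h2 : |γ * a j| ≤ 1 := by
            rw [abs_mul, abs_of_nonneg (ha j)]
            exact mul_le_one₀ hγ (ha j) (ha1 j)
          have h3 := (le_abs_self _).trans (Real.abs_exp_sub_one_sub_id_le h2)
          have h4 : (γ * a j) ^ 2 ≤ γ ^ 2 := by
            rw [mul_pow]
            exact mul_le_of_le_one_right (sq_nonneg _) (pow_le_one₀ (ha j) (ha1 j))
          have := mul_le_mul_of_nonneg_left (h3.trans h4) (hq j)
          linarith
      _ = γ * (∑ j, q j * a j) + γ ^ 2 + 1 := by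
          rw [Finset.sum_add_distrib, Finset.sum_add_distrib, ← Finset.mul_sum, ← Finset.sum_mul,
            hq1]
          ring
      _ ≤ _ := Real.add_one_le_exp _
  calc sumMean q a n (fun s => Real.exp (γ * s)) = (∑ j, q j * Real.exp (γ * a j)) ^ n := by
        rw [sumMean, ← Fin.prod_const, Finset.prod_univ_sum, Fintype.piFinset_univ]
        refine Finset.sum_congr rfl fun x _ => ?_
        rw [Finset.prod_mul_distrib, Finset.mul_sum, Real.exp_sum]
    _ ≤ Real.exp (γ * (∑ j, q j * a j) + γ ^ 2) ^ n :=
        pow_le_pow_left₀ (Finset.sum_nonneg fun j _ =>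
          mul_nonneg (hq j) (Real.exp_pos _).le) h1 n
    _ = _ := by
        rw [← Real.exp_nat_mul]
        ring_nf

include hq hq1 ha ha1 in
theorem sumMean_softThreshold_le {β : ℝ} (hβ : 0 ≤ β) (hβ1 : β ≤ 1) (n : ℕ) (T : ℝ) :
    sumMean q a n (softThreshold β T) ≤
      Real.exp (β * (n * (∑ j, q j * a j) - T) + n * β ^ 2) := by
  calc sumMean q a n (softThreshold β T)
      ≤ sumMean q a n (fun s => Real.exp (-(β * T)) * Real.exp (β * s)) := by
        refine sumMean_mono hq n fun s => (softThreshold_le_exp β T s).trans_eq ?_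
        rw [← Real.exp_add]
        ring_nf
    _ ≤ Real.exp (-(β * T)) * Real.exp (β * (n * ∑ j, q j * a j) + n * β ^ 2) := by
        rw [sumMean_const_mul]
        exact mul_le_mul_of_nonneg_left
          (sumMean_exp_le hq hq1 ha ha1 (by rwa [abs_of_nonneg hβ]) n) (Real.exp_pos _).le
    _ = _ := by
        rw [← Real.exp_add]
        ring_nf

include hq hq1 ha ha1 in
theorem le_sumMean_softThreshold {β : ℝ} (hβ : 0 ≤ β) (hβ1 : β ≤ 1) (n : ℕ) (T : ℝ) :
    1 / 2 * (1 - Real.exp (-β * (n * (∑ j, q j * a j) - T) + n * β ^ 2)) ≤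
      sumMean q a n (softThreshold β T) := by
  have h1 : sumMean q a n (fun s => 1 / 2 + -(1 / 2 * Real.exp (β * T)) * Real.exp (-β * s)) ≤
      sumMean q a n (softThreshold β T) := by
    refine sumMean_mono hq n fun s => le_trans (le_of_eq ?_) (le_softThreshold β T s)
    have : Real.exp (-β * (s - T)) = Real.exp (β * T) * Real.exp (-β * s) := by
      rw [← Real.exp_add]
      ring_nf
    rw [this]
    ring
  rw [sumMean_add, sumMean_const_mul, sumMean_const hq1] at h1
  have h2 := mul_le_mul_of_nonneg_left (sumMean_exp_le hq hq1 ha ha1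
    (γ := -β) (by rwa [abs_neg, abs_of_nonneg hβ]) n) (Real.exp_pos (β * T)).le
  rw [← Real.exp_add] at h2
  have h3 : β * T + (-β * (n * ∑ j, q j * a j) + n * (-β) ^ 2) =
      -β * (n * (∑ j, q j * a j) - T) + n * β ^ 2 := by ring
  rw [h3] at h2
  linarith

include hq hq1 ha ha1 in
/-- Passing a soft threshold multiplies the square root of a distribution by nearly a constant. -/
theorem sumMean_sqrt_sub_sq_le {β : ℝ} (hβ : 0 ≤ β) (hβ1 : β ≤ 1) (n : ℕ)
    (hn : n * β ^ 2 ≤ 1) (T : ℝ) :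
    sumMean q a n (fun s => (√(1 - softThreshold β T s) -
      √(1 - sumMean q a n (softThreshold β T))) ^ 2) ≤
      n * β ^ 2 * sumMean q a n (softThreshold β T) ^ 2 := by
  set p := sumMean q a n (softThreshold β T) with hp
  have hp2 : p ≤ 1 / 2 :=
    (sumMean_mono hq n fun s => softThreshold_le_half β T s).trans_eq (sumMean_const hq1 n _)
  have h1 : ∀ s, (√(1 - softThreshold β T s) - √(1 - p)) ^ 2 ≤
      1 / 2 * softThreshold β T s ^ 2 + (-p * softThreshold β T s + p ^ 2 / 2) := fun s => by
    have hg := softThreshold_le_half β T s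
    set g := softThreshold β T s
    have hu := Real.sq_sqrt (show 0 ≤ 1 - g by linarith)
    have hv := Real.sq_sqrt (show 0 ≤ 1 - p by linarith)
    have hu0 := Real.sqrt_nonneg (1 - g)
    have hv0 := Real.sqrt_nonneg (1 - p)
    set u := √(1 - g)
    set v := √(1 - p)
    have huv : 1 / 2 ≤ u * v := by
      refine le_of_sq_le_sq ?_ (mul_nonneg hu0 hv0)
      rw [mul_pow, hu, hv]
      nlinarith
    have h2 : 2 ≤ (u + v) ^ 2 := by nlinarith
    have h3 : ((u - v) * (u + v)) ^ 2 = (p - g) ^ 2 := by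
      congr 1
      linarith
    have h4 := mul_le_mul_of_nonneg_left h2 (sq_nonneg (u - v))
    nlinarith
  refine (sumMean_mono hq n h1).trans ?_
  rw [sumMean_add, sumMean_add, sumMean_const_mul, sumMean_const_mul, sumMean_const hq1, ← hp]
  have := sumMean_softThreshold_sq_le hq hq1 ha ha1 hβ hβ1 n hn T
  rw [← hp] at this
  linarith

end Mean

/-! ### Sequences of gentle measurements -/

section Gentle

variable {E : Type*} [SeminormedAddCommGroup E] [NormedSpace ℝ E]

/-- The vector `K (t - 1) (⋯ (K 0 w))`. -/
def passVec (K : ℕ → E →ₗ[ℝ] E) (w : E) : ℕ → E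
  | 0 => w
  | t + 1 => K t (passVec K w t)

/-- The norm that `passVec K w t` would have if the measurement at every time `s` were made on
a fresh copy of `w`, with probability `p s` of halting. -/
noncomputable def idealNorm (p : ℕ → ℝ) : ℕ → ℝ
  | 0 => 1
  | t + 1 => √(1 - p t) * idealNorm p t

theorem idealNorm_nonneg (p : ℕ → ℝ) (t : ℕ) : 0 ≤ idealNorm p t := by
  cases t with
  | zero => exact zero_le_one
  | succ t => exact mul_nonneg (Real.sqrt_nonneg _) (idealNorm_nonneg p t)

variable {p : ℕ → ℝ} (hp : ∀ t, 0 ≤ p t) (hp1 : ∀ t, p t ≤ 1)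

include hp1 in
theorem mul_idealNorm_le (t : ℕ) :
    p t * idealNorm p t ≤ 2 * (idealNorm p t - idealNorm p (t + 1)) := by
  have h : √(1 - p t) ≤ 1 - p t / 2 := by
    rw [Real.sqrt_le_left (by linarith [hp1 t])]
    nlinarith [sq_nonneg (p t)]
  have := mul_le_mul_of_nonneg_right h (idealNorm_nonneg p t)
  rw [idealNorm]
  linarith

include hp hp1 in
theorem antitone_idealNorm : Antitone (idealNorm p) :=
  antitone_nat_of_succ_le fun t => by
    have := mul_idealNorm_le hp1 t
    have := mul_nonneg (hp t) (idealNorm_nonneg p t)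
    linarith

variable {K H : ℕ → E →ₗ[ℝ] E} {w : E} {κ : ℝ}
  (hKH : ∀ t x, ‖K t x‖ ^ 2 + ‖H t x‖ ^ 2 = ‖x‖ ^ 2) (hw : ‖w‖ = 1)
  (hκ : 0 ≤ κ) (hclose : ∀ t, ‖K t w - √(1 - p t) • w‖ ≤ κ * p t)

/-- The deviation of `passVec` from the multiple of `w` that it would ideally be. -/
noncomputable def deviation (K : ℕ → E →ₗ[ℝ] E) (w : E) (p : ℕ → ℝ) (t : ℕ) : E :=
  passVec K w t - idealNorm p t • w

theorem deviation_succ (t : ℕ) : deviation K w p (t + 1) =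
    K t (deviation K w p t) + idealNorm p t • (K t w - √(1 - p t) • w) := by
  simp only [deviation, passVec, idealNorm, map_sub, map_smul, smul_sub, smul_smul]
  rw [mul_comm (√(1 - p t))]
  abel

include hp1 hκ hclose in
theorem norm_deviation_succ_le (t : ℕ) : ‖deviation K w p (t + 1)‖ ≤
    ‖K t (deviation K w p t)‖ + 2 * κ * (idealNorm p t - idealNorm p (t + 1)) := by
  rw [deviation_succ]
  refine (norm_add_le _ _).trans (add_le_add le_rfl ?_)
  rw [norm_smul, Real.norm_of_nonneg (idealNorm_nonneg p t)]
  have h1 := mul_le_mul_of_nonneg_left (hclose t) (idealNorm_nonneg p t)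
  have h2 := mul_le_mul_of_nonneg_left (mul_idealNorm_le hp1 t) hκ
  linarith

include hKH in
theorem norm_pass_le (t : ℕ) (x : E) : ‖K t x‖ ≤ ‖x‖ := by
  have := hKH t x
  exact le_of_sq_le_sq (by nlinarith [sq_nonneg ‖H t x‖]) (norm_nonneg _)

include hp1 hKH hκ hclose in
/-- The deviation stays small for all time: its growth in one step is bounded by the decrease of
`idealNorm`, whatever the number of steps. -/
theorem norm_deviation_le (t : ℕ) : ‖deviation K w p t‖ ≤ 2 * κ * (1 - idealNorm p t) := by
  induction t with
  | zero => simp [deviation, passVec, idealNorm]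
  | succ t ih =>
    have h1 := norm_deviation_succ_le hp1 hκ hclose t
    have h2 := norm_pass_le hKH t (deviation K w p t)
    linarith

include hp1 hKH hκ hclose in
/-- The deviation itself leads to halting with small total probability. What it loses by
halting it cannot lose again, and it is replenished only as much as `idealNorm` decreases. -/
theorem sum_norm_halt_deviation_sq_le (T : ℕ) :
    ∑ t ∈ Finset.range T, ‖H t (deviation K w p t)‖ ^ 2 ≤ 8 * κ ^ 2 := by
  suffices h : ∑ t ∈ Finset.range T, ‖H t (deviation K w p t)‖ ^ 2 ≤
      4 * κ * (2 * κ * (1 - idealNorm p T) - ‖deviation K w p T‖) by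
    have h1 := mul_nonneg hκ (norm_nonneg (deviation K w p T))
    have h2 := mul_nonneg (mul_nonneg hκ hκ) (idealNorm_nonneg p T)
    nlinarith
  induction T with
  | zero => simp [deviation, passVec, idealNorm]
  | succ t ih =>
    rw [Finset.sum_range_succ]
    have h1 := norm_deviation_succ_le hp1 hκ hclose t
    have h2 := norm_pass_le hKH t (deviation K w p t)
    have h3 : ‖deviation K w p t‖ ≤ 2 * κ :=
      (norm_deviation_le hp1 hKH hκ hclose t).trans
        (mul_le_of_le_one_right (by linarith) (by linarith [idealNorm_nonneg p t]))
    have h4 := hKH t (deviation K w p t)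
    have h5 : ‖H t (deviation K w p t)‖ ^ 2 ≤
        4 * κ * (‖deviation K w p t‖ - ‖K t (deviation K w p t)‖) := by
      nlinarith [mul_nonneg (sub_nonneg.2 h2) (by linarith :
        0 ≤ 4 * κ - (‖deviation K w p t‖ + ‖K t (deviation K w p t)‖))]
    nlinarith

include hp hp1 hKH hκ hclose in
/-- Measurements that halt on `w` with probability at most `r` each halt on the disturbed vectors
with a total probability that is not much larger. -/
theorem sum_norm_halt_passVec_sq_le {T : ℕ} {r : ℝ} (hH : ∀ t, ‖H t w‖ ^ 2 = p t)
    (S : Finset ℕ) (hS : S ⊆ Finset.range T) (hr : ∀ t ∈ S, p t ≤ r) (hr0 : 0 ≤ r) :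
    ∑ t ∈ S, ‖H t (passVec K w t)‖ ^ 2 ≤ 2 * T * r + 16 * κ ^ 2 := by
  have h1 : ∀ t ∈ S, ‖H t (passVec K w t)‖ ^ 2 ≤ 2 * r + 2 * ‖H t (deviation K w p t)‖ ^ 2 := by
    intro t ht
    have h2 : passVec K w t = idealNorm p t • w + deviation K w p t := by simp [deviation]
    have h3 : ‖H t (passVec K w t)‖ ≤ idealNorm p t * ‖H t w‖ + ‖H t (deviation K w p t)‖ := by
      rw [h2, map_add, map_smul]
      refine (norm_add_le _ _).trans_eq ?_
      rw [norm_smul, Real.norm_of_nonneg (idealNorm_nonneg p t)]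
    have h4 : idealNorm p t ≤ 1 := antitone_idealNorm hp hp1 (Nat.zero_le t)
    have h5 : ‖H t (passVec K w t)‖ ≤ ‖H t w‖ + ‖H t (deviation K w p t)‖ :=
      h3.trans (add_le_add (mul_le_of_le_one_left (norm_nonneg _) h4) le_rfl)
    have h6 := hH t
    have h7 := hr t ht
    nlinarith [norm_nonneg (H t (passVec K w t)),
      sq_nonneg (‖H t w‖ - ‖H t (deviation K w p t)‖)]
  have h8 : (S.card : ℝ) ≤ T := by
    exact_mod_cast (Finset.card_le_card hS).trans_eq (Finset.card_range T)
  calc ∑ t ∈ S, ‖H t (passVec K w t)‖ ^ 2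
      ≤ ∑ t ∈ S, (2 * r + 2 * ‖H t (deviation K w p t)‖ ^ 2) := Finset.sum_le_sum h1
    _ = 2 * S.card * r + 2 * ∑ t ∈ S, ‖H t (deviation K w p t)‖ ^ 2 := by
        rw [Finset.sum_add_distrib, Finset.mul_sum, Finset.sum_const, nsmul_eq_mul]
        ring
    _ ≤ 2 * T * r + 2 * (8 * κ ^ 2) := by
        refine add_le_add (by nlinarith) (mul_le_mul_of_nonneg_left ?_ zero_le_two)
        exact (Finset.sum_le_sum_of_subset_of_nonneg hS fun _ _ _ => sq_nonneg _).trans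
          (sum_norm_halt_deviation_sq_le hp1 hKH hκ hclose T)
    _ = _ := by ring

include hp hp1 hKH hw hκ hclose in
/-- If one of the measurements halts on `w` with probability at least `1 / 4`, then the sequence of
all measurements is likely enough to halt. -/
theorem norm_passVec_sq_le (hκ1 : κ ≤ 1 / 40) {T j : ℕ} (hj : j < T) (hpj : 1 / 4 ≤ p j) :
    ‖passVec K w T‖ ^ 2 ≤ 17 / 20 := by
  have h1 : idealNorm p T ≤ 867 / 1000 := by
    refine (antitone_idealNorm hp hp1 (Nat.succ_le_of_lt hj)).trans ?_
    have h2 : idealNorm p j ≤ 1 := antitone_idealNorm hp hp1 (Nat.zero_le j)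
    -- `867 / 1000` is slightly above `√(3 / 4)`
    have h3 : √(1 - p j) ≤ 867 / 1000 := by
      rw [Real.sqrt_le_left (by norm_num)]
      linarith
    exact (mul_le_of_le_one_right (Real.sqrt_nonneg (1 - p j)) h2).trans h3
  have h4 := norm_deviation_le hp1 hKH hκ hclose T
  have h5 : ‖passVec K w T‖ ≤ ‖deviation K w p T‖ + idealNorm p T := by
    have h6 : passVec K w T = deviation K w p T + idealNorm p T • w := by simp [deviation]
    rw [h6]
    refine (norm_add_le _ _).trans_eq ?_
    rw [norm_smul, Real.norm_of_nonneg (idealNorm_nonneg p T), hw, mul_one]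
  have h7 := idealNorm_nonneg p T
  have h8 : ‖passVec K w T‖ ≤ 917 / 1000 := by nlinarith
  nlinarith [norm_nonneg (passVec K w T)]

end Gentle

/-! ### Functions of the sum of an observable over all copies -/

section FuncSum

variable {d : ℕ} {A : Matrix (Fin d) (Fin d) ℂ} (hA : A.IsHermitian)

/-- The matrix `φ (∑ᵢ A⁽ⁱ⁾)` on `n` systems, where `A⁽ⁱ⁾` is the observable `A` of system `i`. -/
noncomputable def funcSum (n : ℕ) (φ : ℝ → ℝ) : Matrix (Fin n → Fin d) (Fin n → Fin d) ℂ :=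
  tensor (fun _ => (hA.eigenvectorUnitary : Matrix (Fin d) (Fin d) ℂ)) *
    Matrix.diagonal (fun x => (φ (∑ i, hA.eigenvalues (x i)) : ℂ)) *
    tensor (fun _ => (hA.eigenvectorUnitary : Matrix (Fin d) (Fin d) ℂ)ᴴ)

/-- The probability that a measurement of `A` in the state `ρ` yields eigenvector number `j`. -/
noncomputable def eigenProb (ρ : Matrix (Fin d) (Fin d) ℂ) (j : Fin d) : ℝ :=
  ((hA.eigenvectorUnitary : Matrix (Fin d) (Fin d) ℂ)ᴴ * ρ *
    (hA.eigenvectorUnitary : Matrix (Fin d) (Fin d) ℂ)) j j |>.re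

theorem conjTranspose_funcSum (n : ℕ) (φ : ℝ → ℝ) : (funcSum hA n φ)ᴴ = funcSum hA n φ := by
  rw [funcSum, Matrix.conjTranspose_mul, Matrix.conjTranspose_mul, conjTranspose_tensor,
    conjTranspose_tensor, Matrix.diagonal_conjTranspose, Matrix.mul_assoc]
  congr 2
  · simp
  · congr 1
    ext x
    simp

theorem funcSum_mul (n : ℕ) (φ ψ : ℝ → ℝ) :
    funcSum hA n φ * funcSum hA n ψ = funcSum hA n fun s => φ s * ψ s := by
  have h : tensor (fun _ : Fin n => (hA.eigenvectorUnitary : Matrix (Fin d) (Fin d) ℂ)ᴴ) *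
      tensor (fun _ => (hA.eigenvectorUnitary : Matrix (Fin d) (Fin d) ℂ)) = 1 := by
    rw [tensor_mul, ← tensor_one]
    congr 1
    ext1
    exact Unitary.coe_star_mul_self _
  simp only [funcSum]
  rw [Matrix.mul_assoc, Matrix.mul_assoc, ← Matrix.mul_assoc (tensor _) (tensor _ * _),
    ← Matrix.mul_assoc (tensor _) (tensor _), h, Matrix.one_mul, ← Matrix.mul_assoc (.diagonal _),
    Matrix.diagonal_mul_diagonal, ← Matrix.mul_assoc]
  simp

theorem funcSum_add (n : ℕ) (φ ψ : ℝ → ℝ) :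
    funcSum hA n φ + funcSum hA n ψ = funcSum hA n fun s => φ s + ψ s := by
  rw [funcSum, funcSum, ← Matrix.add_mul, ← Matrix.mul_add, Matrix.diagonal_add]
  simp [funcSum]

theorem funcSum_const (n : ℕ) (c : ℝ) : funcSum hA n (fun _ => c) = c • 1 := by
  have h : tensor (fun _ : Fin n => (hA.eigenvectorUnitary : Matrix (Fin d) (Fin d) ℂ)) *
      tensor (fun _ => (hA.eigenvectorUnitary : Matrix (Fin d) (Fin d) ℂ)ᴴ) = 1 := by
    rw [tensor_mul, ← tensor_one]
    congr 1
    ext1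
    exact Unitary.coe_mul_star_self _
  have h2 : Matrix.diagonal (fun _ : Fin n → Fin d => (c : ℂ)) = c • 1 := by
    rw [← Matrix.diagonal_one, ← Matrix.diagonal_smul]
    congr 1
    ext x
    simp
  rw [funcSum, h2, Matrix.mul_smul, Matrix.smul_mul, Matrix.mul_one, h]

variable {ρ : Matrix (Fin d) (Fin d) ℂ}

theorem eigenProb_eq (hρ : IsState ρ) (j : Fin d) : (eigenProb hA ρ j : ℂ) =
    ((hA.eigenvectorUnitary : Matrix (Fin d) (Fin d) ℂ)ᴴ * ρ *
      (hA.eigenvectorUnitary : Matrix (Fin d) (Fin d) ℂ)) j j :=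
  Complex.ext rfl (Complex.nonneg_iff.1 (hρ.1.conjTranspose_mul_mul_same _).diag_nonneg).2

theorem eigenProb_nonneg (hρ : IsState ρ) (j : Fin d) : 0 ≤ eigenProb hA ρ j :=
  (Complex.nonneg_iff.1 (hρ.1.conjTranspose_mul_mul_same _).diag_nonneg).1

/-- Born's rule for functions of the sum of the observables. -/
theorem trace_funcSum_mul_copies (hρ : IsState ρ) (n : ℕ) (φ : ℝ → ℝ) :
    (funcSum hA n φ * copies ρ n).trace =
      (sumMean (eigenProb hA ρ) hA.eigenvalues n φ : ℝ) := by
  have h : copies ρ n = tensor fun _ => ρ := rfl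
  rw [funcSum, Matrix.mul_assoc, Matrix.mul_assoc, Matrix.trace_mul_comm, Matrix.mul_assoc, h,
    tensor_mul, tensor_mul, Matrix.trace, sumMean]
  push_cast
  refine Finset.sum_congr rfl fun x _ => ?_
  rw [Matrix.diag_apply, Matrix.diagonal_mul, mul_comm]
  simp [tensor, eigenProb_eq hA hρ]

theorem sum_eigenProb (hρ : IsState ρ) : ∑ j, eigenProb hA ρ j = 1 := by
  have h : (∑ j, eigenProb hA ρ j : ℂ) = ((hA.eigenvectorUnitary : Matrix (Fin d) (Fin d) ℂ)ᴴ *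
      ρ * (hA.eigenvectorUnitary : Matrix (Fin d) (Fin d) ℂ)).trace :=
    Finset.sum_congr rfl fun j _ => eigenProb_eq hA hρ j
  have h1 : (hA.eigenvectorUnitary : Matrix (Fin d) (Fin d) ℂ) *
      (hA.eigenvectorUnitary : Matrix (Fin d) (Fin d) ℂ)ᴴ = 1 := Unitary.coe_mul_star_self _
  rw [Matrix.trace_mul_comm, ← Matrix.mul_assoc, h1, Matrix.one_mul, hρ.2] at h
  exact_mod_cast h

theorem sum_eigenProb_mul_eigenvalues (hρ : IsState ρ) :
    ∑ j, eigenProb hA ρ j * hA.eigenvalues j = expect ρ A := by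
  have h : ((∑ j, eigenProb hA ρ j * hA.eigenvalues j : ℝ) : ℂ) = (ρ * A).trace := by
    conv_rhs => rw [hA.spectral_theorem, Unitary.conjStarAlgAut_apply, ← Matrix.mul_assoc,
      Matrix.trace_mul_comm, ← Matrix.mul_assoc, ← Matrix.mul_assoc]
    push_cast
    rw [Matrix.trace]
    refine Finset.sum_congr rfl fun j _ => ?_
    rw [Matrix.diag_apply, Matrix.mul_diagonal, eigenProb_eq hA hρ]
    rfl
  rw [expect, ← h, Complex.ofReal_re]

theorem eigenvalues_nonneg (h : IsEvent A) (j : Fin d) : 0 ≤ hA.eigenvalues j :=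
  h.1.eigenvalues_nonneg j

theorem eigenvalues_le_one (h : IsEvent A) (j : Fin d) : hA.eigenvalues j ≤ 1 := by
  have h1 := (h.2.conjTranspose_mul_mul_same
    (hA.eigenvectorUnitary : Matrix (Fin d) (Fin d) ℂ)).diag_nonneg (i := j)
  have h2 : (hA.eigenvectorUnitary : Matrix (Fin d) (Fin d) ℂ)ᴴ *
      (hA.eigenvectorUnitary : Matrix (Fin d) (Fin d) ℂ) = 1 := Unitary.coe_star_mul_self _
  have h3 := hA.conjStarAlgAut_star_eigenvectorUnitary
  rw [Unitary.conjStarAlgAut_apply, ← Unitary.coe_star, star_star] at h3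
  rw [Matrix.mul_sub, Matrix.sub_mul, Matrix.mul_one, h2, Matrix.sub_apply, Matrix.one_apply_eq]
    at h1
  have h4 : ((hA.eigenvectorUnitary : Matrix (Fin d) (Fin d) ℂ)ᴴ * A *
      (hA.eigenvectorUnitary : Matrix (Fin d) (Fin d) ℂ)) j j = hA.eigenvalues j := by
    refine (congrFun (congrFun h3 j) j).trans ?_
    simp
  rw [h4] at h1
  have h5 := (Complex.nonneg_iff.1 h1).1
  simpa using h5

/-- The Kraus operator of halting in the soft measurement of `∑ᵢ A⁽ⁱ⁾`. -/
noncomputable def haltOp (n : ℕ) (β T : ℝ) : Matrix (Fin n → Fin d) (Fin n → Fin d) ℂ :=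
  funcSum hA n fun s => √(softThreshold β T s)

/-- The Kraus operator of passing in the soft measurement of `∑ᵢ A⁽ⁱ⁾`. -/
noncomputable def passOp (n : ℕ) (β T : ℝ) : Matrix (Fin n → Fin d) (Fin n → Fin d) ℂ :=
  funcSum hA n fun s => √(1 - softThreshold β T s)

theorem passOp_haltOp_complete (n : ℕ) (β T : ℝ) :
    (passOp hA n β T)ᴴ * passOp hA n β T + (haltOp hA n β T)ᴴ * haltOp hA n β T = 1 := by
  rw [passOp, haltOp, conjTranspose_funcSum, conjTranspose_funcSum, funcSum_mul, funcSum_mul,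
    funcSum_add]
  have h : ∀ s, √(1 - softThreshold β T s) * √(1 - softThreshold β T s) +
      √(softThreshold β T s) * √(softThreshold β T s) = 1 := fun s => by
    have h1 := softThreshold_le_half β T s
    rw [Real.mul_self_sqrt (by linarith), Real.mul_self_sqrt (softThreshold_pos β T s).le]
    ring
  simp only [h, funcSum_const, one_smul]

/-- The probability that the soft measurement of `∑ᵢ A⁽ⁱ⁾` halts on `n` copies of `ρ`. -/
noncomputable def haltProb (ρ : Matrix (Fin d) (Fin d) ℂ) (n : ℕ) (β T : ℝ) : ℝ :=
  sumMean (eigenProb hA ρ) hA.eigenvalues n (softThreshold β T)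

theorem trace_haltOp (hρ : IsState ρ) (n : ℕ) (β T : ℝ) :
    (haltOp hA n β T * copies ρ n * (haltOp hA n β T)ᴴ).trace = (haltProb hA ρ n β T : ℝ) := by
  rw [Matrix.trace_mul_comm, ← Matrix.mul_assoc, haltOp, conjTranspose_funcSum, funcSum_mul,
    trace_funcSum_mul_copies hA hρ]
  simp only [Real.mul_self_sqrt (softThreshold_pos β T _).le]
  rfl

theorem haltProb_nonneg (hρ : IsState ρ) (n : ℕ) (β T : ℝ) : 0 ≤ haltProb hA ρ n β T :=
  (sumMean_const (sum_eigenProb hA hρ) n 0).symm.trans_le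
    (sumMean_mono (eigenProb_nonneg hA hρ) n fun s => (softThreshold_pos β T s).le)

theorem haltProb_le_one (hρ : IsState ρ) (n : ℕ) (β T : ℝ) : haltProb hA ρ n β T ≤ 1 :=
  ((sumMean_mono (eigenProb_nonneg hA hρ) n fun s => softThreshold_le_half β T s).trans_eq
    (sumMean_const (sum_eigenProb hA hρ) n _)).trans (by norm_num)

theorem haltProb_le_exp (hρ : IsState ρ) (hE : IsEvent A) (n : ℕ) {β : ℝ} (hβ : 0 ≤ β)
    (hβ1 : β ≤ 1) (T : ℝ) :
    haltProb hA ρ n β T ≤ Real.exp (β * (n * expect ρ A - T) + n * β ^ 2) := by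
  rw [← sum_eigenProb_mul_eigenvalues hA hρ]
  exact sumMean_softThreshold_le (eigenProb_nonneg hA hρ) (sum_eigenProb hA hρ)
    (eigenvalues_nonneg hA hE) (eigenvalues_le_one hA hE) hβ hβ1 n T

theorem le_haltProb (hρ : IsState ρ) (hE : IsEvent A) (n : ℕ) {β : ℝ} (hβ : 0 ≤ β)
    (hβ1 : β ≤ 1) (T : ℝ) :
    1 / 2 * (1 - Real.exp (-β * (n * expect ρ A - T) + n * β ^ 2)) ≤ haltProb hA ρ n β T := by
  rw [← sum_eigenProb_mul_eigenvalues hA hρ]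
  exact le_sumMean_softThreshold (eigenProb_nonneg hA hρ) (sum_eigenProb hA hρ)
    (eigenvalues_nonneg hA hE) (eigenvalues_le_one hA hE) hβ hβ1 n T

theorem exists_factor (hρ : IsState ρ) : ∃ B : Matrix (Fin d) (Fin d) ℂ, ρ = B * Bᴴ := by
  open scoped MatrixOrder in
  obtain ⟨B, hB⟩ := CStarAlgebra.nonneg_iff_eq_star_mul_self.mp hρ.1.nonneg
  exact ⟨Bᴴ, by rw [hB, Matrix.conjTranspose_conjTranspose]; rfl⟩

theorem copies_eq_of_factor {B : Matrix (Fin d) (Fin d) ℂ} (hB : ρ = B * Bᴴ) (n : ℕ) :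
    copies ρ n = tensor (fun _ : Fin n => B) * (tensor fun _ : Fin n => B)ᴴ := by
  rw [conjTranspose_tensor, tensor_mul, hB]
  rfl

end FuncSum

section Frobenius

attribute [local instance] Matrix.frobeniusNormedAddCommGroup Matrix.frobeniusNormedSpace

theorem trace_mul_conjTranspose_eq_norm_sq {V W : Type} [Fintype V] [Fintype W]
    (X : Matrix V W ℂ) : (X * Xᴴ).trace = (‖X‖ ^ 2 : ℝ) := by
  rw [Matrix.frobenius_norm_def, ← Real.sqrt_eq_rpow, Real.sq_sqrt (by positivity)]
  push_cast
  simp only [Matrix.trace, Matrix.diag_apply, Matrix.mul_apply, Matrix.conjTranspose_apply]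
  refine Finset.sum_congr rfl fun i _ => Finset.sum_congr rfl fun j _ => ?_
  rw [Complex.star_def, Complex.mul_conj, Complex.normSq_eq_norm_sq]
  simp

theorem norm_sq_pass_add_halt {V : Type} [Fintype V] [DecidableEq V] {K H : Matrix V V ℂ}
    (h : Kᴴ * K + Hᴴ * H = 1) (X : Matrix V V ℂ) : ‖K * X‖ ^ 2 + ‖H * X‖ ^ 2 = ‖X‖ ^ 2 := by
  have h1 : ∀ M : Matrix V V ℂ, ((‖M * X‖ ^ 2 : ℝ) : ℂ) = (Mᴴ * M * (X * Xᴴ)).trace := fun M => by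
    rw [← trace_mul_conjTranspose_eq_norm_sq, Matrix.conjTranspose_mul, ← Matrix.mul_assoc,
      Matrix.trace_mul_comm]
    simp only [Matrix.mul_assoc]
  have h2 : ((‖K * X‖ ^ 2 + ‖H * X‖ ^ 2 : ℝ) : ℂ) = (‖X‖ ^ 2 : ℝ) := by
    rw [Complex.ofReal_add, h1, h1, ← Matrix.trace_add, ← Matrix.add_mul, h, Matrix.one_mul,
      trace_mul_conjTranspose_eq_norm_sq]
  exact_mod_cast h2

variable {d : ℕ} {A : Matrix (Fin d) (Fin d) ℂ} (hA : A.IsHermitian)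
  {ρ B : Matrix (Fin d) (Fin d) ℂ}

theorem norm_funcSum_mul_sq (hρ : IsState ρ) (hB : ρ = B * Bᴴ) (n : ℕ) (φ : ℝ → ℝ) :
    ‖funcSum hA n φ * tensor (fun _ : Fin n => B)‖ ^ 2 =
      sumMean (eigenProb hA ρ) hA.eigenvalues n fun s => φ s ^ 2 := by
  have h : ((‖funcSum hA n φ * tensor (fun _ : Fin n => B)‖ ^ 2 : ℝ) : ℂ) =
      (sumMean (eigenProb hA ρ) hA.eigenvalues n (fun s => φ s ^ 2) : ℝ) := by
    rw [← trace_mul_conjTranspose_eq_norm_sq, Matrix.conjTranspose_mul, ← Matrix.mul_assoc,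
      Matrix.mul_assoc _ _ (tensor _)ᴴ, ← copies_eq_of_factor hB, Matrix.trace_mul_comm,
      conjTranspose_funcSum, ← Matrix.mul_assoc, funcSum_mul, trace_funcSum_mul_copies hA hρ]
    simp only [sq]
  exact_mod_cast h

theorem norm_tensor_factor (hρ : IsState ρ) (hB : ρ = B * Bᴴ) (n : ℕ) :
    ‖tensor (fun _ : Fin n => B)‖ = 1 := by
  have h : ((‖tensor (fun _ : Fin n => B)‖ ^ 2 : ℝ) : ℂ) = 1 := by
    rw [← trace_mul_conjTranspose_eq_norm_sq, conjTranspose_tensor, tensor_mul, ← hB, trace_tensor,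
      hρ.2]
    simp
  have h1 : ‖tensor (fun _ : Fin n => B)‖ ^ 2 = 1 := by exact_mod_cast h
  exact (pow_eq_one_iff_of_nonneg (norm_nonneg _) two_ne_zero).1 h1

theorem norm_haltOp_mul_sq (hρ : IsState ρ) (hB : ρ = B * Bᴴ) (n : ℕ) (β T : ℝ) :
    ‖haltOp hA n β T * tensor (fun _ : Fin n => B)‖ ^ 2 = haltProb hA ρ n β T := by
  rw [haltOp, norm_funcSum_mul_sq hA hρ hB]
  simp only [Real.sq_sqrt (softThreshold_pos β T _).le]
  rfl

/-- The soft measurement is gentle: on passing it changes the (purified) state, up to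
normalization, by an amount that is proportional to the probability of halting. -/
theorem norm_passOp_mul_sub_le (hρ : IsState ρ) (hE : IsEvent A) (hB : ρ = B * Bᴴ) (n : ℕ)
    {β κ : ℝ} (hβ : 0 ≤ β) (hβ1 : β ≤ 1) (hκ : 0 ≤ κ) (hκ1 : κ ≤ 1) (hn : n * β ^ 2 ≤ κ ^ 2)
    (T : ℝ) : ‖passOp hA n β T * tensor (fun _ : Fin n => B) -
      √(1 - haltProb hA ρ n β T) • tensor (fun _ : Fin n => B)‖ ≤ κ * haltProb hA ρ n β T := by
  refine le_of_sq_le_sq ?_ (mul_nonneg hκ (haltProb_nonneg hA hρ n β T))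
  have h1 : passOp hA n β T * tensor (fun _ : Fin n => B) -
      √(1 - haltProb hA ρ n β T) • tensor (fun _ : Fin n => B) =
      funcSum hA n (fun s => √(1 - softThreshold β T s) + -√(1 - haltProb hA ρ n β T)) *
        tensor (fun _ : Fin n => B) := by
    rw [← funcSum_add, funcSum_const, Matrix.add_mul, Matrix.smul_mul, Matrix.one_mul, neg_smul,
      sub_eq_add_neg]
    rfl
  rw [h1, norm_funcSum_mul_sq hA hρ hB]
  simp only [← sub_eq_add_neg]
  refine (sumMean_sqrt_sub_sq_le (eigenProb_nonneg hA hρ) (sum_eigenProb hA hρ)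
    (eigenvalues_nonneg hA hE) (eigenvalues_le_one hA hE) hβ hβ1 n
    (hn.trans (pow_le_one₀ hκ hκ1)) T).trans ?_
  rw [mul_pow]
  exact mul_le_mul_of_nonneg_right hn (sq_nonneg _)

end Frobenius

/-! ### One group of copies -/

section Group

variable {V V' : Type} [Fintype V] [DecidableEq V] [Fintype V'] [DecidableEq V']

/-- The memory of one group: either the group is alive and holds the search register `V` and the
test register `V'`, or it is dead, which is the single basis state `Sum.inr ()`. -/
abbrev GroupMem (V V' : Type) : Type := V × V' ⊕ Unit

/-- Row number `v` of a matrix, as a matrix with a single row. -/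
def row {V W : Type} (N : Matrix V W ℂ) (v : V) : Matrix Unit W ℂ := Matrix.of fun _ => N v

/-- The Kraus operators of one group. The search register is measured by `K` (pass) and `H` (halt);
only after a halt the test register is measured by `K'` (reject) and `H'` (accept). The group goes
on unchanged after a pass (`Sum.inr 0`), dead groups stay dead (`Sum.inr 1`), a halt that the test
accepts is reported (`Sum.inr 2`), and a halt that the test rejects makes the group dead (`Sum.inl v`,
where `v` is the basis state that is discarded). -/
noncomputable def groupKraus (K H : Matrix V V ℂ) (K' H' : Matrix V' V' ℂ) :
    V × V' ⊕ Fin 3 → Matrix (GroupMem V V') (GroupMem V V') ℂ :=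
  Sum.elim (fun v => Matrix.fromBlocks 0 0 (row (H ⊗ₖ K') v) 0)
    ![Matrix.fromBlocks (K ⊗ₖ 1) 0 0 0, Matrix.fromBlocks 0 0 0 1,
      Matrix.fromBlocks (H ⊗ₖ H') 0 0 0]

/-- The outcome to which a Kraus operator of a group belongs: only an accepted halt is reported. -/
def groupOut : V × V' ⊕ Fin 3 → Response :=
  Sum.elim (fun _ => .pass) ![.pass, .pass, .halt]

variable {K H : Matrix V V ℂ} {K' H' : Matrix V' V' ℂ}

omit [DecidableEq V] in
theorem sum_row_mul {W : Type} (N : Matrix V W ℂ) : ∑ v, (row N v)ᴴ * row N v = Nᴴ * N := by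
  ext a b
  rw [Matrix.sum_apply]
  simp [row, Matrix.mul_apply]

omit [DecidableEq V] in
theorem sum_mul_row {W : Type} [Fintype W] (N : Matrix V W ℂ) (σ : Matrix W W ℂ) :
    ∑ v, row N v * σ * (row N v)ᴴ = Matrix.of fun _ _ : Unit => (N * σ * Nᴴ).trace := by
  ext a b
  rw [Matrix.sum_apply]
  simp [row, Matrix.mul_apply, Matrix.trace]

theorem sum_fromBlocks₁₁ {ι W W' : Type} [Fintype ι] (M : ι → Matrix W W ℂ) :
    ∑ v, Matrix.fromBlocks (M v) 0 0 (0 : Matrix W' W' ℂ) =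
      Matrix.fromBlocks (∑ v, M v) 0 0 0 := by
  ext (a | a) (b | b) <;> simp [Matrix.sum_apply]

theorem sum_fromBlocks₂₂ {ι W W' : Type} [Fintype ι] (M : ι → Matrix W' W' ℂ) :
    ∑ v, Matrix.fromBlocks (0 : Matrix W W ℂ) 0 0 (M v) =
      Matrix.fromBlocks 0 0 0 (∑ v, M v) := by
  ext (a | a) (b | b) <;> simp [Matrix.sum_apply]

theorem groupKraus_complete (h : Kᴴ * K + Hᴴ * H = 1) (h' : K'ᴴ * K' + H'ᴴ * H' = 1) :
    ∑ k, (groupKraus K H K' H' k)ᴴ * groupKraus K H K' H' k = 1 := by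
  have h1 : (H ⊗ₖ K')ᴴ * (H ⊗ₖ K') + ((K ⊗ₖ 1)ᴴ * (K ⊗ₖ (1 : Matrix V' V' ℂ)) +
      (H ⊗ₖ H')ᴴ * (H ⊗ₖ H')) = 1 := by
    simp only [Matrix.conjTranspose_kronecker, ← Matrix.mul_kronecker_mul]
    rw [add_left_comm, ← Matrix.kronecker_add, h', Matrix.conjTranspose_one, Matrix.one_mul,
      ← Matrix.add_kronecker, h, Matrix.one_kronecker_one]
  simp only [Fintype.sum_sum_type, Fin.sum_univ_three, groupKraus, Sum.elim_inl, Sum.elim_inr,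
    Matrix.cons_val_zero, Matrix.cons_val_one, Matrix.cons_val, Matrix.fromBlocks_conjTranspose,
    Matrix.fromBlocks_multiply, Matrix.conjTranspose_zero, Matrix.mul_zero, Matrix.zero_mul,
    add_zero, zero_add, sum_fromBlocks₁₁, sum_row_mul, Matrix.fromBlocks_add,
    Matrix.conjTranspose_one, Matrix.mul_one]
  rw [h1, Matrix.fromBlocks_one]

/-- The states of one group: `σ` is the unnormalized state of a live group, and `y` is the
probability that the group is dead. -/
def groupState (σ : Matrix (V × V') (V × V') ℂ) (y : ℂ) :
    Matrix (GroupMem V V') (GroupMem V V') ℂ :=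
  Matrix.fromBlocks σ 0 0 (Matrix.of fun _ _ => y)

omit [DecidableEq V] [DecidableEq V'] in
theorem trace_groupState (σ : Matrix (V × V') (V × V') ℂ) (y : ℂ) :
    (groupState σ y).trace = σ.trace + y := by
  simp [groupState, Matrix.trace, Fintype.sum_sum_type]

omit [DecidableEq V] in
/-- The state of one group after it has reported nothing. -/
theorem sum_groupKraus_pass (σ : Matrix V V ℂ) (τ : Matrix V' V' ℂ) (y : ℂ) :
    ∑ k, (if groupOut k = Response.pass then groupKraus K H K' H' k * groupState (σ ⊗ₖ τ) y *
      (groupKraus K H K' H' k)ᴴ else 0) =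
    groupState ((K * σ * Kᴴ) ⊗ₖ τ) (y + (H * σ * Hᴴ).trace * (K' * τ * K'ᴴ).trace) := by
  simp only [Fintype.sum_sum_type, Fin.sum_univ_three, groupKraus, groupOut, Sum.elim_inl,
    Sum.elim_inr, Matrix.cons_val_zero, Matrix.cons_val_one, Matrix.cons_val,
    Matrix.fromBlocks_conjTranspose, groupState, if_true, reduceCtorEq, if_false,
    Matrix.fromBlocks_multiply, Matrix.conjTranspose_zero, Matrix.mul_zero, Matrix.zero_mul,
    add_zero, zero_add, sum_fromBlocks₂₂, sum_mul_row, Matrix.fromBlocks_add,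
    Matrix.conjTranspose_one, Matrix.mul_one, Matrix.one_mul]
  simp only [Matrix.conjTranspose_kronecker, ← Matrix.mul_kronecker_mul, Matrix.trace_kronecker,
    Matrix.conjTranspose_one, Matrix.mul_one, Matrix.one_mul]
  congr 1
  ext a b
  simp [add_comm]

end Group

/-! ### Many groups side by side -/

section Parallel

variable {R : ℕ} {W κ : Type} [Fintype W] [DecidableEq W] [Fintype κ]

/-- The response to the outcomes of all groups: pass if none of them reports a halt. -/
def parallelOut (out : κ → Response) (k : Fin R → κ) : Response :=
  if ∀ r, out (k r) = .pass then .pass else .halt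

omit [Fintype κ] in
theorem parallelOut_eq_pass (out : κ → Response) (k : Fin R → κ) :
    parallelOut out k = .pass ↔ ∀ r, out (k r) = .pass := by
  unfold parallelOut
  split_ifs <;> simp_all

theorem tensor_complete {M : κ → Matrix W W ℂ} (h : ∑ k, (M k)ᴴ * M k = 1) :
    ∑ k : Fin R → κ, (tensor fun r => M (k r))ᴴ * tensor (fun r => M (k r)) = 1 := by
  simp only [conjTranspose_tensor, tensor_mul]
  rw [sum_tensor fun k => (M k)ᴴ * M k, h, tensor_one]

omit [DecidableEq W] in
/-- The groups stay independent as long as all of them pass. -/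
theorem sum_tensor_pass (M : κ → Matrix W W ℂ) (out : κ → Response) (σ : Matrix W W ℂ) :
    ∑ k : Fin R → κ, (if parallelOut out k = .pass then tensor (fun r => M (k r)) *
      tensor (fun _ => σ) * (tensor fun r => M (k r))ᴴ else 0) =
    tensor fun _ => ∑ k, if out k = .pass then M k * σ * (M k)ᴴ else 0 := by
  rw [← sum_tensor fun k => if out k = .pass then M k * σ * (M k)ᴴ else 0]
  refine Finset.sum_congr rfl fun k _ => ?_
  by_cases hk : ∀ r, out (k r) = .pass
  · rw [if_pos ((parallelOut_eq_pass _ _).2 hk), conjTranspose_tensor, tensor_mul, tensor_mul]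
    simp only [hk, if_true]
  · rw [if_neg (mt (parallelOut_eq_pass _ _).1 hk)]
    obtain ⟨r, hr⟩ := not_forall.1 hk
    ext a b
    simp only [tensor, Matrix.of_apply, Matrix.zero_apply]
    refine (Finset.prod_eq_zero (Finset.mem_univ r) ?_).symm
    rw [if_neg hr, Matrix.zero_apply]

/-- The division of `R * (n + n')` systems into `R` groups, each of them with `n` systems in the
search register and `n'` systems in the test register. -/
def groupEquiv (d R n n' : ℕ) :
    (Fin (R * (n + n')) → Fin d) ≃ (Fin R → (Fin n → Fin d) × (Fin n' → Fin d)) :=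
  (Equiv.arrowCongr finProdFinEquiv.symm (Equiv.refl _)).trans <| (Equiv.curry _ _ _).trans <|
    Equiv.arrowCongr (Equiv.refl _) <|
      (Equiv.arrowCongr finSumFinEquiv.symm (Equiv.refl _)).trans
        (Equiv.sumArrowEquivProdArrow _ _ _)

theorem copies_submatrix_groupEquiv {d : ℕ} (ρ : Matrix (Fin d) (Fin d) ℂ) (R n n' : ℕ) :
    (copies ρ (R * (n + n'))).submatrix (groupEquiv d R n n').symm (groupEquiv d R n n').symm =
      tensor fun _ => copies ρ n ⊗ₖ copies ρ n' := by
  ext a b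
  simp only [copies, tensor, Matrix.submatrix_apply, Matrix.of_apply, Matrix.kroneckerMap_apply]
  rw [← finProdFinEquiv.prod_comp, Fintype.prod_prod_type]
  refine Finset.prod_congr rfl fun r _ => ?_
  rw [← finSumFinEquiv.prod_comp, Fintype.prod_sum_type]
  simp [groupEquiv, Equiv.arrowCongr, Equiv.sumArrowEquivProdArrow]

end Parallel

/-! ### The online algorithm -/

/-- The parameters of the algorithm: the number `groups` of groups, the numbers of copies for the
search and the test of each group, the rates `β` of the two soft thresholds, and how far these lie
below the threshold of the query. -/
structure Params where
  /-- the number of groups -/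
  groups : ℕ
  /-- the number of copies in a search register -/
  nSearch : ℕ
  /-- the number of copies in a test register -/
  nTest : ℕ
  /-- the rate of the soft threshold of the search -/
  βSearch : ℝ
  /-- the rate of the soft threshold of the test -/
  βTest : ℝ
  /-- the offset of the soft threshold of the search, per copy -/
  offSearch : ℝ
  /-- the offset of the soft threshold of the test, per copy -/
  offTest : ℝ

namespace Params

variable (P : Params) {d m : ℕ}

/-- The total number of copies. -/
abbrev total : ℕ := P.groups * (P.nSearch + P.nTest)

/-- The Kraus operator of the search that passes on a query. -/
noncomputable def searchPass (q : Query d) :=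
  passOp q.isEvent.1.1 P.nSearch P.βSearch (P.nSearch * (q.threshold - P.offSearch))

/-- The Kraus operator of the search that halts on a query. -/
noncomputable def searchHalt (q : Query d) :=
  haltOp q.isEvent.1.1 P.nSearch P.βSearch (P.nSearch * (q.threshold - P.offSearch))

/-- The Kraus operator of the test that rejects a query. -/
noncomputable def testReject (q : Query d) :=
  passOp q.isEvent.1.1 P.nTest P.βTest (P.nTest * (q.threshold - P.offTest))

/-- The Kraus operator of the test that accepts a query. -/
noncomputable def testAccept (q : Query d) :=
  haltOp q.isEvent.1.1 P.nTest P.βTest (P.nTest * (q.threshold - P.offTest))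

/-- The basis of the memory of all groups. -/
abbrev Mem (d : ℕ) : Type :=
  Fin P.groups → GroupMem (Fin P.nSearch → Fin d) (Fin P.nTest → Fin d)

/-- The enumeration of the basis of the memory. -/
noncomputable def memEquiv (d : ℕ) : Fin (Fintype.card (P.Mem d)) ≃ P.Mem d :=
  (Fintype.equivFin _).symm

/-- The inclusion of the copies into the memory, in which all groups are alive. -/
noncomputable def inclusion (d : ℕ) : Matrix (P.Mem d) (Fin P.total → Fin d) ℂ :=
  (tensor fun _ => Matrix.fromRows 1 0).submatrix id
    (groupEquiv d P.groups P.nSearch P.nTest)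

theorem fromRows_isometry {V : Type} [Fintype V] [DecidableEq V] :
    (Matrix.fromRows (1 : Matrix V V ℂ) (0 : Matrix Unit V ℂ))ᴴ *
      Matrix.fromRows (1 : Matrix V V ℂ) (0 : Matrix Unit V ℂ) = 1 := by
  rw [Matrix.conjTranspose_fromRows_eq_fromCols_conjTranspose, Matrix.fromCols_mul_fromRows]
  simp

theorem submatrix_isometry {V W V' W' : Type} [Fintype V] [DecidableEq V] [Fintype W]
    [Fintype V'] [DecidableEq V'] [Fintype W'] (e : W' ≃ W) (f : V' ≃ V) (M : Matrix W V ℂ) :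
    (M.submatrix e f)ᴴ * M.submatrix e f = (Mᴴ * M).submatrix f f := by
  rw [Matrix.conjTranspose_submatrix, Matrix.submatrix_mul_equiv]

/-- The preparation of the memory from the copies. -/
noncomputable def prepareInstrument (d : ℕ) :
    Instrument Unit (Fin P.total → Fin d) (Fin (Fintype.card (P.Mem d))) :=
  Instrument.ofKraus (κ := Unit) (fun _ => (P.inclusion d).submatrix (P.memEquiv d) (Equiv.refl _))
    id (by
      have h : (P.inclusion d)ᴴ * P.inclusion d = 1 := by
        rw [inclusion, ← Equiv.coe_refl, submatrix_isometry, conjTranspose_tensor, tensor_mul,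
          fromRows_isometry, tensor_one, Matrix.submatrix_one_equiv]
      rw [Fintype.sum_unique, submatrix_isometry, h, Matrix.submatrix_one_equiv])

/-- The Kraus operators of a group when the query `q` is presented. -/
noncomputable def queryKraus (q : Query d) :=
  groupKraus (P.searchPass q) (P.searchHalt q) (P.testReject q) (P.testAccept q)

theorem queryKraus_complete (q : Query d) :
    ∑ k, (P.queryKraus q k)ᴴ * P.queryKraus q k = 1 :=
  groupKraus_complete (passOp_haltOp_complete _ _ _ _) (passOp_haltOp_complete _ _ _ _)

/-- The measurement of the memory when the query `q` is presented. -/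
noncomputable def stepInstrument (q : Query d) :
    Instrument Response (Fin (Fintype.card (P.Mem d))) (Fin (Fintype.card (P.Mem d))) :=
  Instrument.ofKraus (fun k : Fin P.groups → _ =>
      (tensor fun r => P.queryKraus q (k r)).submatrix (P.memEquiv d) (P.memEquiv d))
    (parallelOut groupOut) (by
      simp only [submatrix_isometry]
      have h := congrArg (fun M => M.submatrix (P.memEquiv d) (P.memEquiv d))
        (tensor_complete (R := P.groups) (P.queryKraus_complete q))
      simp only [Matrix.submatrix_one_equiv] at h
      rw [← h]
      ext a b
      simp only [Matrix.sum_apply, Matrix.submatrix_apply])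

/-- The algorithm: `P.groups` groups search independently, and it halts as soon as one of them
reports a halt that its test has accepted. -/
noncomputable abbrev algorithm (d m : ℕ) : OnlineAlgorithm d P.total m where
  memDim := Fintype.card (P.Mem d)
  prepare := P.prepareInstrument d
  step t qs := P.stepInstrument (qs (Fin.last t))

theorem prepareInstrument_apply (ρ : Matrix (Fin d) (Fin d) ℂ) :
    (P.prepareInstrument d).apply () (copies ρ P.total) =
      (tensor fun _ : Fin P.groups =>
        groupState (copies ρ P.nSearch ⊗ₖ copies ρ P.nTest) 0).submatrix
          (P.memEquiv d) (P.memEquiv d) := by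
  have h0 := copies_submatrix_groupEquiv ρ P.groups P.nSearch P.nTest
  have h1 : copies ρ P.total = (tensor fun _ : Fin P.groups => copies ρ P.nSearch ⊗ₖ
      copies ρ P.nTest).submatrix (groupEquiv d P.groups P.nSearch P.nTest)
        (groupEquiv d P.groups P.nSearch P.nTest) := by
    rw [← h0, Matrix.submatrix_submatrix]
    simp [total]
  refine (Instrument.ofKraus_apply _ _ _ _ _).trans ?_
  rw [Fintype.sum_unique, if_pos rfl, h1, inclusion, Matrix.submatrix_submatrix,
    Matrix.conjTranspose_submatrix]
  simp only [Function.comp_def, Equiv.refl_apply]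
  rw [Matrix.submatrix_mul_equiv, Matrix.submatrix_mul_equiv, conjTranspose_tensor, tensor_mul,
    tensor_mul]
  congr 2
  ext1 r
  rw [Matrix.conjTranspose_fromRows_eq_fromCols_conjTranspose, Matrix.fromRows_mul,
    Matrix.fromRows_mul_fromCols, groupState]
  simp
  rfl

theorem stepInstrument_apply_pass (q : Query d)
    (σ : Matrix (Fin P.nSearch → Fin d) (Fin P.nSearch → Fin d) ℂ)
    (τ : Matrix (Fin P.nTest → Fin d) (Fin P.nTest → Fin d) ℂ) (y : ℂ) :
    (P.stepInstrument q).apply .pass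
      ((tensor fun _ : Fin P.groups => groupState (σ ⊗ₖ τ) y).submatrix
        (P.memEquiv d) (P.memEquiv d)) =
      (tensor fun _ : Fin P.groups =>
        groupState ((P.searchPass q * σ * (P.searchPass q)ᴴ) ⊗ₖ τ)
          (y + (P.searchHalt q * σ * (P.searchHalt q)ᴴ).trace *
            (P.testReject q * τ * (P.testReject q)ᴴ).trace)).submatrix
        (P.memEquiv d) (P.memEquiv d) := by
  refine (Instrument.ofKraus_apply _ _ _ _ _).trans ?_
  rw [← sum_groupKraus_pass (H' := P.testAccept q), ← sum_tensor_pass]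
  ext a b
  rw [Matrix.submatrix_apply, Matrix.sum_apply, Matrix.sum_apply]
  refine Finset.sum_congr rfl fun k _ => ?_
  split_ifs
  · rw [Matrix.conjTranspose_submatrix, Matrix.submatrix_mul_equiv, Matrix.submatrix_mul_equiv,
      Matrix.submatrix_apply]
    rfl
  · rfl

section Run

attribute [local instance] Matrix.frobeniusNormedAddCommGroup Matrix.frobeniusNormedSpace

variable (Q : ℕ → Query d) (B : Matrix (Fin d) (Fin d) ℂ)

/-- The purified search register of a group that has passed on the first `t` queries. -/
noncomputable def searchVec : ℕ → Matrix (Fin P.nSearch → Fin d) (Fin P.nSearch → Fin d) ℂ :=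
  passVec (fun t => LinearMap.mulLeft ℝ (P.searchPass (Q t))) (tensor fun _ => B)

/-- The probability that the search of a group halts at query number `t`. -/
noncomputable def searchProb (t : ℕ) : ℝ := ‖P.searchHalt (Q t) * P.searchVec Q B t‖ ^ 2

/-- The probability that a test accepts query number `t`. -/
noncomputable def acceptProb (ρ : Matrix (Fin d) (Fin d) ℂ) (t : ℕ) : ℝ :=
  haltProb (Q t).isEvent.1.1 ρ P.nTest P.βTest (P.nTest * ((Q t).threshold - P.offTest))

/-- The probability that a group reports no halt during the first `T` queries. -/
noncomputable def silentProb (ρ : Matrix (Fin d) (Fin d) ℂ) (T : ℕ) : ℝ :=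
  1 - ∑ t ∈ Finset.range T, P.searchProb Q B t * P.acceptProb Q ρ t

variable {Q B} {ρ : Matrix (Fin d) (Fin d) ℂ} (hρ : IsState ρ) (hB : ρ = B * Bᴴ)

include hρ hB in
theorem norm_searchVec_sq (T : ℕ) :
    ‖P.searchVec Q B T‖ ^ 2 = 1 - ∑ t ∈ Finset.range T, P.searchProb Q B t := by
  induction T with
  | zero =>
    rw [Finset.range_zero, Finset.sum_empty, searchVec, passVec, norm_tensor_factor hρ hB]
    norm_num
  | succ T ih =>
    have h := norm_sq_pass_add_halt (passOp_haltOp_complete (Q T).isEvent.1.1 P.nSearch P.βSearch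
      (P.nSearch * ((Q T).threshold - P.offSearch))) (P.searchVec Q B T)
    rw [Finset.sum_range_succ, ← sub_sub, ← ih, ← h, add_sub_assoc]
    simp [searchVec, passVec, searchProb, searchPass, searchHalt]

include hρ in
theorem trace_testReject (t : ℕ) :
    (P.testReject (Q t) * copies ρ P.nTest * (P.testReject (Q t))ᴴ).trace =
      (1 - P.acceptProb Q ρ t : ℝ) := by
  have h := passOp_haltOp_complete (Q t).isEvent.1.1 P.nTest P.βTest
    (P.nTest * ((Q t).threshold - P.offTest))
  have h1 := trace_haltOp (Q t).isEvent.1.1 hρ P.nTest P.βTest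
    (P.nTest * ((Q t).threshold - P.offTest))
  have h2 : (copies ρ P.nTest).trace = 1 := by
    refine (trace_tensor _).trans ?_
    simp [hρ.2]
  rw [Matrix.trace_mul_comm, ← Matrix.mul_assoc] at h1 ⊢
  rw [testReject, eq_sub_of_add_eq h, Matrix.sub_mul, Matrix.one_mul, Matrix.trace_sub, h1, h2,
    acceptProb]
  push_cast
  rfl

include hρ hB in
theorem passState_eq (q : Fin m → Query d) (hQ : ∀ t : Fin m, Q t = q t) (t : Fin (m + 1)) :
    (P.algorithm d m).passState ρ q t = (tensor fun _ : Fin P.groups =>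
      groupState ((P.searchVec Q B t * (P.searchVec Q B t)ᴴ) ⊗ₖ copies ρ P.nTest)
        (∑ s ∈ Finset.range t, P.searchProb Q B s * (1 - P.acceptProb Q ρ s) : ℝ)).submatrix
      (P.memEquiv d) (P.memEquiv d) := by
  induction t using Fin.induction with
  | zero =>
    refine (P.prepareInstrument_apply ρ).trans ?_
    rw [copies_eq_of_factor hB P.nSearch]
    simp [searchVec, passVec]
  | succ t ih =>
    have h : (P.algorithm d m).passState ρ q t.succ = (P.stepInstrument (q t)).apply .pass
      ((P.algorithm d m).passState ρ q t.castSucc) := rfl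
    rw [h, ih, stepInstrument_apply_pass]
    have h1 : P.searchHalt (q t) * (P.searchVec Q B t.castSucc * (P.searchVec Q B t.castSucc)ᴴ) *
        (P.searchHalt (q t))ᴴ = (P.searchHalt (q t) * P.searchVec Q B t) *
          (P.searchHalt (q t) * P.searchVec Q B t)ᴴ := by
      rw [Matrix.conjTranspose_mul]
      simp only [Matrix.mul_assoc, Fin.val_castSucc]
    have h2 : P.searchPass (q t) * (P.searchVec Q B t.castSucc * (P.searchVec Q B t.castSucc)ᴴ) *
        (P.searchPass (q t))ᴴ = P.searchVec Q B t.succ * (P.searchVec Q B t.succ)ᴴ := by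
      have h3 : P.searchVec Q B t.succ = P.searchPass (q t) * P.searchVec Q B t := by
        rw [← hQ]
        rfl
      rw [h3, Matrix.conjTranspose_mul]
      simp only [Matrix.mul_assoc, Fin.val_castSucc]
    have h4 : (∑ s ∈ Finset.range t.castSucc,
          P.searchProb Q B s * (1 - P.acceptProb Q ρ s) : ℝ) +
        (P.searchHalt (q t) * (P.searchVec Q B t.castSucc * (P.searchVec Q B t.castSucc)ᴴ) *
          (P.searchHalt (q t))ᴴ).trace *
        (P.testReject (q t) * copies ρ P.nTest * (P.testReject (q t))ᴴ).trace =
        ((∑ s ∈ Finset.range t.succ, P.searchProb Q B s * (1 - P.acceptProb Q ρ s) : ℝ) : ℂ) := by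
      rw [h1, trace_mul_conjTranspose_eq_norm_sq, ← hQ, P.trace_testReject hρ, Fin.val_succ,
        Finset.sum_range_succ, ← Complex.ofReal_mul, ← Complex.ofReal_add]
      rfl
    rw [h2, h4]

include hρ hB in
theorem trace_passState (q : Fin m → Query d) (hQ : ∀ t : Fin m, Q t = q t) (t : Fin (m + 1)) :
    ((P.algorithm d m).passState ρ q t).trace = (P.silentProb Q B ρ t ^ P.groups : ℝ) := by
  have h : ∀ M : Matrix (P.Mem d) (P.Mem d) ℂ,
      (M.submatrix (P.memEquiv d) (P.memEquiv d)).trace = M.trace := fun M =>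
    (P.memEquiv d).sum_comp fun i => M i i
  have h1 : (copies ρ P.nTest).trace = 1 := by
    refine (trace_tensor _).trans ?_
    simp [hρ.2]
  rw [P.passState_eq hρ hB q hQ]
  refine (h _).trans ?_
  rw [trace_tensor, trace_groupState, Matrix.trace_kronecker, h1,
    trace_mul_conjTranspose_eq_norm_sq, P.norm_searchVec_sq hρ hB, Fin.prod_const, mul_one,
    ← Complex.ofReal_add, ← Complex.ofReal_pow, silentProb]
  congr 2
  simp only [mul_sub, mul_one, Finset.sum_sub_distrib]
  ring

include hρ hB in
theorem outputProb_none (q : Fin m → Query d) (hQ : ∀ t : Fin m, Q t = q t) :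
    (P.algorithm d m).outputProb ρ q none = P.silentProb Q B ρ m ^ P.groups := by
  rw [OnlineAlgorithm.outputProb, P.trace_passState hρ hB q hQ, Complex.ofReal_re, Fin.val_last]

include hρ hB in
theorem outputProb_some (q : Fin m → Query d) (hQ : ∀ t : Fin m, Q t = q t) (j : Fin m) :
    (P.algorithm d m).outputProb ρ q (some j) =
      P.silentProb Q B ρ j ^ P.groups - P.silentProb Q B ρ (j + 1) ^ P.groups := by
  have h := (P.stepInstrument (q j)).sum_trace_apply
    ((P.algorithm d m).passState ρ q j.castSucc)
  have h1 : ∀ f : Response → ℂ, ∑ o, f o = f .pass + f .halt := fun f => by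
    refine (Finset.sum_pair (by simp)).trans rfl
  have h2 := P.trace_passState hρ hB q hQ j.succ
  rw [h1, P.trace_passState hρ hB q hQ] at h
  have h3 : (P.algorithm d m).passState ρ q j.succ = (P.stepInstrument (q j)).apply .pass
    ((P.algorithm d m).passState ρ q j.castSucc) := rfl
  rw [← h3, h2] at h
  refine (congrArg Complex.re (eq_sub_of_add_eq' h)).trans ?_
  rw [← Complex.ofReal_sub, Complex.ofReal_re, Fin.val_castSucc, Fin.val_succ]

end Run

/-! ### The failure probability -/

section Analysis

attribute [local instance] Matrix.frobeniusNormedAddCommGroup Matrix.frobeniusNormedSpace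

variable {P : Params} {d m : ℕ} {Q : ℕ → Query d} {B ρ : Matrix (Fin d) (Fin d) ℂ}

/-- The requirements on the parameters: for the search, that passing is gentle and that the
probability of a false halt on an undisturbed state is at most `1 / (40 m)`; for the test, that the
probability `η` of a false acceptance is small even when summed over all groups; and that there are
so many groups that it is unlikely that all of them fail. -/
structure Suitable (P : Params) (m : ℕ) (ε δ η : ℝ) : Prop where
  offSearch_eq : P.offSearch = ε / 4
  offTest_eq : P.offTest = 3 * ε / 4
  βSearch_nonneg : 0 ≤ P.βSearch
  βSearch_le_one : P.βSearch ≤ 1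
  gentle : P.nSearch * P.βSearch ^ 2 ≤ (1 / 40) ^ 2
  search : Real.exp (-P.βSearch * (P.nSearch * (ε / 4)) + P.nSearch * P.βSearch ^ 2) ≤
    1 / (40 * m)
  βTest_nonneg : 0 ≤ P.βTest
  βTest_le_one : P.βTest ≤ 1
  test : Real.exp (-P.βTest * (P.nTest * (ε / 4)) + P.nTest * P.βTest ^ 2) ≤ η
  η_le_half : η ≤ 1 / 2
  η_mul_groups : P.groups * η ≤ δ / 2
  pow_groups : (49 / 50 : ℝ) ^ P.groups ≤ δ / 2

theorem haltProb_le_of_gap {A : Matrix (Fin d) (Fin d) ℂ} (hE : IsEvent A) (hρ : IsState ρ)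
    (n : ℕ) {β θ s γ : ℝ} (hβ : 0 ≤ β) (hβ1 : β ≤ 1) (h : expect ρ A ≤ θ - s - γ) :
    haltProb hE.1.1 ρ n β (n * (θ - s)) ≤ Real.exp (-β * (n * γ) + n * β ^ 2) := by
  refine (haltProb_le_exp hE.1.1 hρ hE n hβ hβ1 _).trans (Real.exp_le_exp.2 ?_)
  have := mul_le_mul_of_nonneg_left h (mul_nonneg hβ (Nat.cast_nonneg (α := ℝ) n))
  linarith

theorem quarter_le_haltProb_of_gap {A : Matrix (Fin d) (Fin d) ℂ} (hE : IsEvent A)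
    (hρ : IsState ρ) (n : ℕ) {β θ s γ : ℝ} (hβ : 0 ≤ β) (hβ1 : β ≤ 1)
    (h : θ - s + γ ≤ expect ρ A) (hγ : Real.exp (-β * (n * γ) + n * β ^ 2) ≤ 1 / 2) :
    1 / 4 ≤ haltProb hE.1.1 ρ n β (n * (θ - s)) := by
  refine le_trans ?_ (le_haltProb hE.1.1 hρ hE n hβ hβ1 _)
  have h1 : Real.exp (-β * (n * expect ρ A - n * (θ - s)) + n * β ^ 2) ≤ 1 / 2 := by
    refine le_trans (Real.exp_le_exp.2 ?_) hγ
    have := mul_le_mul_of_nonneg_left h (mul_nonneg hβ (Nat.cast_nonneg (α := ℝ) n))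
    linarith
  linarith

theorem searchProb_nonneg (t : ℕ) : 0 ≤ P.searchProb Q B t := sq_nonneg _

section

variable (hρ : IsState ρ)

include hρ in
theorem acceptProb_nonneg (t : ℕ) : 0 ≤ P.acceptProb Q ρ t := haltProb_nonneg _ hρ _ _ _

include hρ in
theorem acceptProb_le_one (t : ℕ) : P.acceptProb Q ρ t ≤ 1 := haltProb_le_one _ hρ _ _ _

variable (hB : ρ = B * Bᴴ)

include hρ hB in
theorem sum_searchProb_le_one (T : ℕ) : ∑ t ∈ Finset.range T, P.searchProb Q B t ≤ 1 := by
  have := P.norm_searchVec_sq (Q := Q) hρ hB T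
  linarith [sq_nonneg ‖P.searchVec Q B T‖]

theorem silentProb_sub_succ (T : ℕ) : P.silentProb Q B ρ T - P.silentProb Q B ρ (T + 1) =
    P.searchProb Q B T * P.acceptProb Q ρ T := by
  rw [silentProb, silentProb, Finset.sum_range_succ]
  ring

include hρ hB in
theorem silentProb_nonneg (T : ℕ) : 0 ≤ P.silentProb Q B ρ T := by
  have h : ∑ t ∈ Finset.range T, P.searchProb Q B t * P.acceptProb Q ρ t ≤
      ∑ t ∈ Finset.range T, P.searchProb Q B t := Finset.sum_le_sum fun t _ =>
    mul_le_of_le_one_right (searchProb_nonneg t) (acceptProb_le_one hρ t)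
  have := sum_searchProb_le_one (P := P) (Q := Q) hρ hB T
  rw [silentProb]
  linarith

include hρ in
theorem silentProb_le_one (T : ℕ) : P.silentProb Q B ρ T ≤ 1 := by
  rw [silentProb]
  linarith [Finset.sum_nonneg fun t (_ : t ∈ Finset.range T) =>
    mul_nonneg (searchProb_nonneg (P := P) (Q := Q) (B := B) t)
      (acceptProb_nonneg (P := P) (Q := Q) hρ t)]

variable {ε δ η : ℝ} (hP : P.Suitable m ε δ η)

include hρ hP in
theorem acceptProb_le (t : ℕ) (ht : expect ρ (Q t).obs ≤ (Q t).threshold - ε) :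
    P.acceptProb Q ρ t ≤ η := by
  refine (haltProb_le_of_gap (Q t).isEvent hρ P.nTest hP.βTest_nonneg hP.βTest_le_one
    (γ := ε / 4) ?_).trans hP.test
  rw [hP.offTest_eq]
  linarith

include hρ hP in
theorem quarter_le_acceptProb (t : ℕ) (ht : (Q t).threshold - ε / 2 < expect ρ (Q t).obs) :
    1 / 4 ≤ P.acceptProb Q ρ t := by
  refine quarter_le_haltProb_of_gap (Q t).isEvent hρ P.nTest hP.βTest_nonneg hP.βTest_le_one
    (γ := ε / 4) ?_ (hP.test.trans hP.η_le_half)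
  rw [hP.offTest_eq]
  linarith

include hρ hB hP in
/-- If the expectation of one of the observables exceeds its threshold, a group reports a halt
with at least constant probability. Most of its halts are at queries whose expectation
is above `θ - ε / 2`, and the test accepts these with probability at least `1 / 4`. -/
theorem silentProb_le (hm : 1 ≤ m) {j : ℕ} (hj : j < m)
    (hviol : (Q j).threshold < expect ρ (Q j).obs) : P.silentProb Q B ρ m ≤ 49 / 50 := by
  classical
  have hm' : (1 : ℝ) ≤ m := by exact_mod_cast hm
  let p : ℕ → ℝ := fun t => haltProb (Q t).isEvent.1.1 ρ P.nSearch P.βSearch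
    (P.nSearch * ((Q t).threshold - P.offSearch))
  have hp : ∀ t, 0 ≤ p t := fun t => haltProb_nonneg _ hρ _ _ _
  have hp1 : ∀ t, p t ≤ 1 := fun t => haltProb_le_one _ hρ _ _ _
  let K := fun t => LinearMap.mulLeft ℝ (P.searchPass (Q t))
  let H := fun t => LinearMap.mulLeft ℝ (P.searchHalt (Q t))
  have hKH : ∀ t x, ‖K t x‖ ^ 2 + ‖H t x‖ ^ 2 = ‖x‖ ^ 2 := fun t x =>
    norm_sq_pass_add_halt (passOp_haltOp_complete _ _ _ _) x
  have hclose : ∀ t, ‖K t (tensor fun _ => B) - √(1 - p t) • tensor fun _ => B‖ ≤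
      1 / 40 * p t := fun t =>
    norm_passOp_mul_sub_le _ hρ (Q t).isEvent hB _ hP.βSearch_nonneg hP.βSearch_le_one
      (by norm_num) (by norm_num) hP.gentle _
  have hH : ∀ t, ‖H t (tensor fun _ => B)‖ ^ 2 = p t := fun t =>
    norm_haltOp_mul_sq _ hρ hB _ _ _
  set S := (Finset.range m).filter fun t => expect ρ (Q t).obs ≤ (Q t).threshold - ε / 2
  have hfalse : ∑ t ∈ S, P.searchProb Q B t ≤ 2 * m * (1 / (40 * m)) + 16 * (1 / 40) ^ 2 := by
    refine sum_norm_halt_passVec_sq_le hp hp1 hKH (by norm_num) hclose hH S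
      (Finset.filter_subset _ _) (fun t ht => ?_) (by positivity)
    refine (haltProb_le_of_gap (Q t).isEvent hρ P.nSearch hP.βSearch_nonneg hP.βSearch_le_one
      (γ := ε / 4) ?_).trans hP.search
    rw [hP.offSearch_eq]
    linarith [(Finset.mem_filter.1 ht).2]
  have hsmall : 1 / (40 * m : ℝ) ≤ 1 / 2 :=
    one_div_le_one_div_of_le (by norm_num) (by linarith)
  have hpj : 1 / 4 ≤ p j := by
    refine quarter_le_haltProb_of_gap (Q j).isEvent hρ P.nSearch hP.βSearch_nonneg
      hP.βSearch_le_one (γ := ε / 4) ?_ (hP.search.trans hsmall)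
    rw [hP.offSearch_eq]
    linarith
  have hpass : ‖P.searchVec Q B m‖ ^ 2 ≤ 17 / 20 :=
    norm_passVec_sq_le hp hp1 hKH (norm_tensor_factor hρ hB _) (by norm_num) hclose le_rfl hj hpj
  rw [P.norm_searchVec_sq hρ hB] at hpass
  have hsplit := Finset.sum_filter_add_sum_filter_not (Finset.range m)
    (fun t => expect ρ (Q t).obs ≤ (Q t).threshold - ε / 2) (P.searchProb Q B)
  have htrue : 1 / 4 * ∑ t ∈ (Finset.range m).filter
      (fun t => ¬expect ρ (Q t).obs ≤ (Q t).threshold - ε / 2), P.searchProb Q B t ≤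
      ∑ t ∈ Finset.range m, P.searchProb Q B t * P.acceptProb Q ρ t := by
    rw [Finset.mul_sum]
    refine (Finset.sum_le_sum fun t ht => ?_).trans (Finset.sum_le_sum_of_subset_of_nonneg
      (Finset.filter_subset _ _) fun t _ _ =>
        mul_nonneg (searchProb_nonneg t) (acceptProb_nonneg hρ t))
    rw [mul_comm]
    exact mul_le_mul_of_nonneg_left (quarter_le_acceptProb hρ hP t
      (not_le.1 (Finset.mem_filter.1 ht).2)) (searchProb_nonneg t)
  have hval : 2 * m * (1 / (40 * m)) + 16 * (1 / 40) ^ 2 = (3 / 50 : ℝ) := by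
    field_simp
    norm_num
  rw [hval] at hfalse
  rw [silentProb]
  linarith

theorem pow_sub_pow_le_mul {x y : ℝ} (hy : 0 ≤ y) (hyx : y ≤ x) (hx : x ≤ 1) (R : ℕ) :
    x ^ R - y ^ R ≤ R * (x - y) := by
  induction R with
  | zero => simp
  | succ R ih =>
    have h1 : x ^ R ≤ 1 := pow_le_one₀ (hy.trans hyx) hx
    have h2 : 0 ≤ x ^ R - y ^ R := sub_nonneg.2 (pow_le_pow_left₀ hy hyx R)
    have h3 : x ^ (R + 1) - y ^ (R + 1) = x ^ R * (x - y) + y * (x ^ R - y ^ R) := by ring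
    rw [h3]
    push_cast
    nlinarith [mul_le_mul_of_nonneg_right h1 (sub_nonneg.2 hyx),
      mul_le_mul_of_nonneg_right (hyx.trans hx) h2]

end

open Classical in
theorem failureProb_le {ε δ η : ℝ} (hP : P.Suitable m ε δ η) (hm : 1 ≤ m) (hρ : IsState ρ)
    (q : Fin m → Query d) : (P.algorithm d m).failureProb ρ q ε ≤ δ := by
  obtain ⟨B, hB⟩ := exists_factor hρ
  -- Queries beyond the `m`-th never matter; any extension of the sequence to `ℕ` will do.
  let Q : ℕ → Query d := fun t => q ⟨t % m, Nat.mod_lt t hm⟩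
  have hQ : ∀ t : Fin m, Q t = q t := fun t =>
    congrArg q (Fin.ext (Nat.mod_eq_of_lt t.isLt))
  have hη : 0 ≤ η := (Real.exp_pos _).le.trans hP.test
  have hδ : 0 ≤ δ / 2 := (by positivity : (0 : ℝ) ≤ (49 / 50) ^ P.groups).trans hP.pow_groups
  have hnone : (if OutputTrue ρ q ε none then 0 else (P.algorithm d m).outputProb ρ q none) ≤
      δ / 2 := by
    split_ifs with h
    · exact hδ
    · obtain ⟨j, hj⟩ := not_forall.1 h
      rw [← hQ] at hj
      rw [P.outputProb_none hρ hB q hQ]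
      exact (pow_le_pow_left₀ (silentProb_nonneg hρ hB m)
        (silentProb_le hρ hB hP hm j.isLt (not_le.1 hj)) _).trans hP.pow_groups
  have hsome : ∀ j : Fin m,
      (if OutputTrue ρ q ε (some j) then 0 else (P.algorithm d m).outputProb ρ q (some j)) ≤
        P.groups * η * P.searchProb Q B j := fun j => by
    split_ifs with h
    · exact mul_nonneg (mul_nonneg (Nat.cast_nonneg _) hη) (searchProb_nonneg _)
    · have h1 := silentProb_sub_succ (P := P) (Q := Q) (B := B) (ρ := ρ) j
      have h2 : P.acceptProb Q ρ j ≤ η := by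
        refine acceptProb_le hρ hP j ?_
        rw [hQ]
        exact not_lt.1 h
      have h3 := mul_nonneg (searchProb_nonneg (P := P) (Q := Q) (B := B) j)
        (acceptProb_nonneg (P := P) (Q := Q) hρ j)
      rw [P.outputProb_some hρ hB q hQ]
      refine (pow_sub_pow_le_mul (silentProb_nonneg hρ hB _) (by linarith)
        (silentProb_le_one hρ _) _).trans ?_
      rw [h1, mul_assoc, mul_comm η]
      exact mul_le_mul_of_nonneg_left (mul_le_mul_of_nonneg_left h2 (searchProb_nonneg _))
        (Nat.cast_nonneg _)
  have hsum : ∑ j : Fin m, P.groups * η * P.searchProb Q B j ≤ δ / 2 := by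
    rw [← Finset.mul_sum, Fin.sum_univ_eq_sum_range (fun t => P.searchProb Q B t)]
    exact (mul_le_of_le_one_right (mul_nonneg (Nat.cast_nonneg _) hη)
      (sum_searchProb_le_one hρ hB m)).trans hP.η_mul_groups
  rw [OnlineAlgorithm.failureProb, Fintype.sum_option]
  have := (Finset.sum_le_sum fun j (_ : j ∈ Finset.univ) => hsome j).trans hsum
  linarith

end Analysis

/-! ### The number of copies -/

/-- The number of groups for failure probability `δ`. A group fails to report a halt, where it should,
with probability at most `49 / 50 ≤ exp (-1 / 50)`. -/
noncomputable def groupCount (δ : ℝ) : ℕ := ⌈50 * Real.log (2 / δ)⌉₊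

/-- Parameters for `m` queries, accuracy `ε` and failure probability `δ`. The rate `βSearch` is the
largest for which passing is gentle; with it, the probability of a false halt is at most
`exp (-βSearch * nSearch * ε / 4)` up to a constant factor, so `√nSearch` has to be of
order `(log m + 1) / ε`. -/
noncomputable def choice (m : ℕ) (ε δ : ℝ) : Params where
  groups := groupCount δ
  nSearch := ⌈(160 * (Real.log m + 5) / ε) ^ 2⌉₊
  nTest := ⌈64 * Real.log (2 * groupCount δ / δ) / ε ^ 2⌉₊
  βSearch := 1 / (40 * √(⌈(160 * (Real.log m + 5) / ε) ^ 2⌉₊))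
  βTest := ε / 8
  offSearch := ε / 4
  offTest := 3 * ε / 4

variable {m : ℕ} {ε δ : ℝ} (hm : 1 ≤ m) (hε : 0 < ε) (hε2 : ε < 1 / 2) (hδ : 0 < δ)
  (hδ2 : δ < 1 / 2)

include hδ hδ2 in
theorem one_le_two_mul_log : 1 ≤ 2 * Real.log (1 / δ) := by
  have h : Real.log 2 ≤ Real.log (1 / δ) := by
    refine Real.log_le_log two_pos ?_
    rw [le_div_iff₀ hδ]
    linarith
  linarith [Real.log_two_gt_d9]

include hδ hδ2 in
theorem log_two_div_pos : 0 < Real.log (2 / δ) := by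
  refine Real.log_pos ?_
  rw [lt_div_iff₀ hδ]
  linarith

include hδ hδ2 in
theorem one_le_groupCount : 1 ≤ groupCount δ :=
  Nat.one_le_iff_ne_zero.2 (Nat.ceil_pos.2 (by linarith [log_two_div_pos hδ hδ2])).ne'

include hm hε hε2 hδ hδ2 in
theorem suitable_choice :
    (choice m ε δ).Suitable m ε δ (δ / (2 * groupCount δ)) := by
  have hm' : (1 : ℝ) ≤ m := by exact_mod_cast hm
  have hR : (1 : ℝ) ≤ groupCount δ := by exact_mod_cast one_le_groupCount hδ hδ2
  have hℓ : 0 ≤ Real.log m := Real.log_nonneg hm'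
  -- the square root `u` of the number of copies of the search
  have hN : (160 * (Real.log m + 5) / ε) ^ 2 ≤ ((choice m ε δ).nSearch : ℝ) := Nat.le_ceil _
  have hu : 160 * (Real.log m + 5) / ε ≤ √((choice m ε δ).nSearch) :=
    Real.le_sqrt_of_sq_le hN
  have hu2 : √((choice m ε δ).nSearch : ℝ) ^ 2 = (choice m ε δ).nSearch :=
    Real.sq_sqrt (Nat.cast_nonneg _)
  have hβ : (choice m ε δ).βSearch = 1 / (40 * √((choice m ε δ).nSearch)) := rfl
  set N := ((choice m ε δ).nSearch : ℝ)
  set u := √N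
  have hu1 : 1 ≤ u := by
    refine le_trans ?_ hu
    rw [le_div_iff₀ hε]
    linarith
  have hgentle : N * (choice m ε δ).βSearch ^ 2 = (1 / 40) ^ 2 := by
    rw [hβ, ← hu2]
    field_simp
  refine ⟨rfl, rfl, ?_, ?_, hgentle.le, ?_, ?_, ?_, ?_, ?_, ?_, ?_⟩
  · rw [hβ]
    positivity
  · rw [hβ, div_le_one (by positivity)]
    linarith
  · have h1 : -(choice m ε δ).βSearch * (N * (ε / 4)) + N * (choice m ε δ).βSearch ^ 2 ≤
        -(Real.log m + 4) := by
      have h2 : (choice m ε δ).βSearch * (N * (ε / 4)) = u * ε / 160 := by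
        rw [hβ, ← hu2]
        field_simp
        norm_num
      rw [div_le_iff₀ hε] at hu
      rw [neg_mul, h2, hgentle]
      linarith
    refine (Real.exp_le_exp.2 h1).trans ?_
    have h3 : 40 ≤ Real.exp 4 := by
      have h4 : Real.exp 4 = Real.exp 1 ^ 4 := by
        rw [← Real.exp_nat_mul]
        norm_num
      rw [h4]
      calc (40 : ℝ) ≤ 2.7 ^ 4 := by norm_num
        _ ≤ _ := pow_le_pow_left₀ (by norm_num) (by linarith [Real.exp_one_gt_d9]) 4
    rw [Real.exp_neg, Real.exp_add, Real.exp_log (by linarith), ← one_div]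
    exact one_div_le_one_div_of_le (by positivity) (by nlinarith)
  · exact (by positivity : (0 : ℝ) ≤ ε / 8)
  · exact (by linarith : ε / 8 ≤ 1)
  · have h1 : 64 * Real.log (2 * groupCount δ / δ) / ε ^ 2 ≤ ((choice m ε δ).nTest : ℝ) :=
      Nat.le_ceil _
    have hβT : (choice m ε δ).βTest = ε / 8 := rfl
    rw [div_le_iff₀ (by positivity)] at h1
    have h2 : -(choice m ε δ).βTest * ((choice m ε δ).nTest * (ε / 4)) +
        (choice m ε δ).nTest * (choice m ε δ).βTest ^ 2 ≤
        -Real.log (2 * groupCount δ / δ) := by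
      rw [hβT]
      linarith
    refine (Real.exp_le_exp.2 h2).trans_eq ?_
    rw [Real.exp_neg, Real.exp_log (by positivity), inv_div]
  · rw [div_le_iff₀ (by positivity)]
    linarith
  · refine le_of_eq ?_
    change (groupCount δ : ℝ) * _ = _
    field_simp
  · calc (49 / 50 : ℝ) ^ groupCount δ ≤ Real.exp (-(1 / 50)) ^ groupCount δ :=
          pow_le_pow_left₀ (by norm_num) (by linarith [Real.add_one_le_exp (-(1 / 50) : ℝ)]) _
      _ = Real.exp (-(groupCount δ / 50)) := by
          rw [← Real.exp_nat_mul]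
          ring_nf
      _ ≤ Real.exp (-Real.log (2 / δ)) := by
          have : 50 * Real.log (2 / δ) ≤ groupCount δ := Nat.le_ceil _
          exact Real.exp_le_exp.2 (by linarith)
      _ = δ / 2 := by rw [Real.exp_neg, Real.exp_log (by positivity), inv_div]

include hm hε hε2 hδ hδ2 in
theorem total_choice_le : ((choice m ε δ).total : ℝ) ≤
    (Real.log m ^ 2 + Real.log (1 / δ)) / ε ^ 2 * (300000000 * Real.log (1 / δ)) := by
  have hm' : (1 : ℝ) ≤ m := by exact_mod_cast hm
  have hR : (1 : ℝ) ≤ groupCount δ := by exact_mod_cast one_le_groupCount hδ hδ2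
  have hℓ : 0 ≤ Real.log m := Real.log_nonneg hm'
  have hL := one_le_two_mul_log hδ hδ2
  have hlog2 : Real.log (2 / δ) ≤ 2 * Real.log (1 / δ) := by
    rw [two_mul, ← Real.log_mul (by positivity) (by positivity)]
    refine Real.log_le_log (by positivity) ?_
    rw [div_le_iff₀ hδ]
    field_simp
    linarith
  have hlogR : Real.log (2 * groupCount δ / δ) =
      Real.log (2 * groupCount δ) + Real.log (1 / δ) := by
    rw [← Real.log_mul (by positivity) (by positivity), mul_one_div]
  set L := Real.log (1 / δ)
  set ℓ := Real.log m
  have hLpos : 0 < L := by linarith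
  have hRle : (groupCount δ : ℝ) ≤ 102 * L := by
    have := (Nat.ceil_lt_add_one (a := 50 * Real.log (2 / δ))
      (by linarith [log_two_div_pos hδ hδ2])).le
    change (groupCount δ : ℝ) ≤ _ at this
    linarith
  have hlogR2 : Real.log (2 * groupCount δ) ≤ 407 * L := by
    calc Real.log (2 * groupCount δ) ≤ Real.log (204 * L) :=
          Real.log_le_log (by linarith) (by linarith)
      _ = Real.log 204 + Real.log L := Real.log_mul (by norm_num) hLpos.ne'
      _ ≤ 203 + L := add_le_add
          ((Real.log_le_sub_one_of_pos (by norm_num)).trans (by norm_num))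
          ((Real.log_le_sub_one_of_pos hLpos).trans (by linarith))
      _ ≤ 407 * L := by linarith
  have hlogR0 : 0 ≤ Real.log (2 * groupCount δ / δ) := by
    rw [hlogR]
    exact add_nonneg (Real.log_nonneg (by linarith)) hLpos.le
  have hε1 : ε ^ 2 ≤ 1 := pow_le_one₀ hε.le (by linarith)
  have hN : ((choice m ε δ).nSearch : ℝ) * ε ^ 2 ≤ 51200 * ℓ ^ 2 + 2560002 * L := by
    have h1 : ((choice m ε δ).nSearch : ℝ) ≤ (160 * (ℓ + 5) / ε) ^ 2 + 1 :=
      (Nat.ceil_lt_add_one (by positivity)).le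
    have h2 := mul_le_mul_of_nonneg_right h1 (sq_nonneg ε)
    have h3 : ((160 * (ℓ + 5) / ε) ^ 2 + 1) * ε ^ 2 = 25600 * (ℓ + 5) ^ 2 + ε ^ 2 := by
      field_simp
      ring
    nlinarith [sq_nonneg (ℓ - 5)]
  have hT : ((choice m ε δ).nTest : ℝ) * ε ^ 2 ≤ 26114 * L := by
    have h1 : ((choice m ε δ).nTest : ℝ) ≤ 64 * Real.log (2 * groupCount δ / δ) / ε ^ 2 + 1 :=
      (Nat.ceil_lt_add_one (by positivity)).le
    have h2 := mul_le_mul_of_nonneg_right h1 (sq_nonneg ε)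
    have h3 : (64 * Real.log (2 * groupCount δ / δ) / ε ^ 2 + 1) * ε ^ 2 =
        64 * Real.log (2 * groupCount δ / δ) + ε ^ 2 := by
      field_simp
    linarith
  have hsum : ((choice m ε δ).nSearch : ℝ) + (choice m ε δ).nTest ≤
      2600000 * ((ℓ ^ 2 + L) / ε ^ 2) := by
    rw [← mul_div_assoc, le_div_iff₀ (by positivity)]
    nlinarith [sq_nonneg ℓ]
  have htotal : ((choice m ε δ).total : ℝ) =
      groupCount δ * ((choice m ε δ).nSearch + (choice m ε δ).nTest) := by
    rw [total]
    push_cast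
    rfl
  have hX : 0 ≤ (ℓ ^ 2 + L) / ε ^ 2 := by positivity
  rw [htotal]
  calc (groupCount δ : ℝ) * ((choice m ε δ).nSearch + (choice m ε δ).nTest)
      ≤ 102 * L * (2600000 * ((ℓ ^ 2 + L) / ε ^ 2)) :=
        mul_le_mul hRle hsum (by positivity) (by positivity)
    _ ≤ _ := by nlinarith [mul_nonneg hX hLpos.le]

end Params

end ThresholdSearch

/-- The pairs are presented as an arbitrary sequence `q`, chosen after the algorithm and with full
knowledge of it and of the state. Adaptive choice adds nothing: as long as pairs are presented, all
earlier responses have been "pass". -/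
theorem mainTheorem1 :
    ∃ (C : ℝ) (nTS : ℕ → ℝ → ℝ → ℕ), 0 < C ∧
      ∀ (m : ℕ) (ε δ : ℝ), 1 ≤ m → 0 < ε → ε < 1 / 2 → 0 < δ → δ < 1 / 2 →
        (nTS m ε δ : ℝ) ≤
            (Real.log m ^ 2 + Real.log (1 / δ)) / ε ^ 2 * (C * Real.log (1 / δ)) ∧
        ∀ d : ℕ, ∃ alg : ThresholdSearch.OnlineAlgorithm d (nTS m ε δ) m,
          ∀ ρ : Matrix (Fin d) (Fin d) ℂ, ThresholdSearch.IsState ρ →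
            ∀ q : Fin m → ThresholdSearch.Query d, alg.failureProb ρ q ε ≤ δ :=
  ⟨300000000, fun m ε δ => (ThresholdSearch.Params.choice m ε δ).total, by norm_num,
    fun m _ _ hm hε hε2 hδ hδ2 => ⟨ThresholdSearch.Params.total_choice_le hm hε hε2 hδ hδ2,
      fun d => ⟨ThresholdSearch.Params.algorithm _ d m, fun _ hρ q =>
        ThresholdSearch.Params.failureProb_le
          (ThresholdSearch.Params.suitable_choice hm hε hε2 hδ hδ2) hm hρ q⟩⟩⟩
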